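/- **Setting.** Let $D\subset\mathbb{R}^d$ be open and let $S\subset\partial D$ be closed (the singular set of $D$), of Hausdorff dimension $\delta\in\mathbb{N}_0$. Assume that this dimension is attained at an edge of $D$: there are a point $x_0\in S$ and smooth local coordinates centred at $x_0$ in which $S$ is a $\delta$-dimensional linear subspace $V$ and $D$ is a nonempty open cone that is invariant under translations along $V$. (Examples: $D=\mathbb{R}^d\setminus\mathbb{R}^\delta$ with $S=\mathbb{R}^\delta$, $0\le\delta<d$; a polytope with its vertices, edges, …, $(d-2)$-faces, where $\delta=d-2$; $\mathbb{R}^d\setminus S$ for the singular set $S$ of a polytope.) Let $\rho:D\to(0,1]$ be smooth and equivalent to $\operatorname{dist}(\cdot,S)$ in a neighbourhood $\{x\in D:\operatorname{dist}(x,S)<\varepsilon\}$ of the singular set. For $m\in\mathbb{N}$, $a\in\mathbb{R}$, $1<p<\infty$, let $\mathcal{K}^m_{a,p}(D)$ be the Kondratiev space of all $u:D\to\mathbb{C}$ that have weak derivatives up to order $m$ in $D$ and a finite norm $$\|u|\mathcal{K}^m_{a,p}(D)\|=\Bigl(\sum_{|\alpha|\le m}\int_D|\rho(x)^{|\alpha|-a}\partial^\alpha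 u(x)|^p\,dx\Bigr)^{1/p}.$$ Let $\varphi_0\in\mathcal{S}(\mathbb{R}^d)$ with $\varphi_0(x)=1$ for $|x|\le1$ and $\varphi_0(x)=0$ for $|x|\ge\frac32$, let $\varphi_j=\varphi_0(2^{-j}\cdot)-\varphi_0(2^{-j+1}\cdot)$ for $j\ge1$, and $$\|f|F^s_{\tau,q}(\mathbb{R}^d)\|=\Bigl\|\Bigl(\sum_{j\ge0}2^{jsq}|\mathcal{F}^{-1}(\varphi_j\mathcal{F}f)|^q\Bigr)^{1/q}\Big|L_\tau(\mathbb{R}^d)\Bigr\|.$$ For dyadic cubes $Q_{j,k}=2^{-j}((0,1)^d+k)$, $j\ge0$, $k\in\mathbb{Z}^d$, let $2Q_{j,k}$ be the concentric open cube of twice the side length. Let $\{Q_{j,k}\}_{(j,k)\in W}$ be a Whitney decomposition of $D$: pairwise disjoint cubes such that $D$ is the union of their closures, $\operatorname{dist}(2Q_{j,k},\partial D)\sim2^{-j}$ for $j\ge1$, and $\operatorname{dist}(2Q_{0,k},\partial D)\ge c>0$. Let $\psi_{j,k}\ge0$, $(j,k)\in W$, be $C^\infty$ functions with $\operatorname{supp}\psi_{j,k}\subset2Q_{j,k}$,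 $\sum_{(j,k)\in W}\psi_{j,k}=1$ on $D$, and $|\partial^\alpha\psi_{j,k}|\le c_\alpha2^{j|\alpha|}$ for all $\alpha$. The refined localization space $F^{m,\mathrm{rloc}}_{\tau,2}(D)$ consists of all locally integrable $f$ on $D$ with $$\|f|F^{m,\mathrm{rloc}}_{\tau,2}(D)\|=\Bigl(\sum_{(j,k)\in W}\|\psi_{j,k}f|F^m_{\tau,2}(\mathbb{R}^d)\|^\tau\Bigr)^{1/\tau}<\infty.$$ **Proposition.** Let $m\in\mathbb{N}$, $m\ge1$, $a\in\mathbb{R}$, $1<p<\infty$, $0<\tau<p$, and let either $$m-a=(d-\delta)\Bigl(\frac1\tau-\frac1p\Bigr)\ \text{ and }\ a<m,\qquad\text{or}\qquad m-a>(d-\delta)\Bigl(\frac1\tau-\frac1p\Bigr).$$ Then there is a function $u\in\mathcal{K}^m_{a,p}(D)$ with $\|\rho^{-m}u|L_\tau(D)\|=\infty$. Moreover, for all choices of the Whitney decomposition $W$, of the resolution of unity $(\psi_{j,k})$ and of $\varphi_0$, the space $\mathcal{K}^m_{a,p}(D)$ is not continuously embedded into $F^{m,\mathrm{rloc}}_{\tau,2}(D)$,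 i.e., there is no constant $C<\infty$ such that every $u\in\mathcal{K}^m_{a,p}(D)$ belongs to $F^{m,\mathrm{rloc}}_{\tau,2}(D)$ with $\|u|F^{m,\mathrm{rloc}}_{\tau,2}(D)\|\le C\|u|\mathcal{K}^m_{a,p}(D)\|$. -/

import Mathlib

open MeasureTheory Set
open scoped ENNReal NNReal ContDiff FourierTransform SchwartzMap

noncomputable section

/-- `ℝ^d` with the Euclidean norm. -/
abbrev Eucl (d : ℕ) : Type := EuclideanSpace ℝ (Fin d)

/-! ### Domains and their singular sets -/

/-- `x` is a point of a `δ`-dimensional edge of `D`, and `S` is that edge near `x`: in smooth local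
coordinates centred at `x`, the set `S` is a `δ`-dimensional linear subspace `V`, and `D` is an open
cone which is invariant under translations along `V` (that is, the product of `V` with an open cone
in a complement of `V`). Examples: the complement of a `δ`-dimensional subspace, and a polytope near
a point in the relative interior of a face of the largest dimension in its singular set. -/
def IsEdgePoint {d : ℕ} (D S : Set (Eucl d)) (δ : ℕ) (x : Eucl d) : Prop :=
  ∃ (V : Submodule ℝ (Eucl d)) (K : Set (Eucl d)) (Φ : OpenPartialHomeomorph (Eucl d) (Eucl d)),
    Module.finrank ℝ V = δ ∧
    IsOpen K ∧ K.Nonempty ∧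
    (∀ t : ℝ, 0 < t → ∀ y ∈ K, t • y ∈ K) ∧
    (∀ v ∈ V, ∀ y ∈ K, y + v ∈ K) ∧
    ContDiffOn ℝ ∞ Φ Φ.source ∧ ContDiffOn ℝ ∞ Φ.symm Φ.target ∧
    x ∈ Φ.source ∧ Φ x = 0 ∧
    ∀ y ∈ Φ.source, (y ∈ S ↔ Φ y ∈ V) ∧ (y ∈ D ↔ Φ y ∈ K)

/-- `D` is a domain (open set) with closed singular set `S ⊆ ∂D` of dimension `δ`, where the
dimension is the Hausdorff dimension and is attained at an edge of `D`. -/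
structure IsDomainWithSingularSet {d : ℕ} (D S : Set (Eucl d)) (δ : ℕ) : Prop where
  isOpen : IsOpen D
  isClosed : IsClosed S
  subset_frontier : S ⊆ frontier D
  dimH_eq : dimH S = (δ : ℝ≥0∞)
  exists_edge : ∃ x, IsEdgePoint D S δ x

/-- `ρ` is a smooth function on `D` with values in `(0, 1]` which near the singular set `S` is
equivalent to the distance to `S`. -/
structure IsSmoothDistance {d : ℕ} (D S : Set (Eucl d)) (ρ : Eucl d → ℝ) : Prop where
  contDiffOn : ContDiffOn ℝ ∞ ρ D
  pos : ∀ x ∈ D, 0 < ρ x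
  le_one : ∀ x ∈ D, ρ x ≤ 1
  equiv : ∃ ε c C : ℝ, 0 < ε ∧ 0 < c ∧ 0 < C ∧ ∀ x ∈ D, Metric.infDist x S < ε →
    c * Metric.infDist x S ≤ ρ x ∧ ρ x ≤ C * Metric.infDist x S

/-! ### Partial derivatives and weak derivatives -/

/-- The list of coordinate directions of the multi-index `α`, in which `i` occurs `α i` times. -/
def directions {d : ℕ} (α : Fin d → ℕ) : List (Fin d) :=
  (List.finRange d).flatMap fun i => List.replicate (α i) i

/-- The classical partial derivative `∂^α f`. -/
def partialDeriv {d : ℕ} (α : Fin d → ℕ) (f : Eucl d → ℝ) (x : Eucl d) : ℝ :=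
  iteratedFDeriv ℝ (directions α).length f x
    fun i => EuclideanSpace.single ((directions α).get i) (1 : ℝ)

/-- `g` is the weak derivative `∂^α u` in the open set `D`. -/
def HasWeakDeriv {d : ℕ} (D : Set (Eucl d)) (α : Fin d → ℕ) (u g : Eucl d → ℂ) : Prop :=
  LocallyIntegrableOn u D ∧ LocallyIntegrableOn g D ∧
  ∀ θ : Eucl d → ℝ, ContDiff ℝ ∞ θ → HasCompactSupport θ → tsupport θ ⊆ D →
    ∫ x in D, partialDeriv α θ x • u x = (-1 : ℝ) ^ (∑ i, α i) • ∫ x in D, θ x • g x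

/-! ### Kondratiev spaces -/

/-- The norm of `u` in `𝒦^m_{a,p}(D)`. Weak derivatives are unique up to null sets, so the infimum
is over one value; it is `∞` if one of the weak derivatives of order at most `m` does not exist. -/
def kondratievNorm {d : ℕ} (D : Set (Eucl d)) (ρ : Eucl d → ℝ) (m : ℕ) (a p : ℝ)
    (u : Eucl d → ℂ) : ℝ≥0∞ :=
  ⨅ (g : (Fin d → ℕ) → Eucl d → ℂ) (_ : ∀ α, ∑ i, α i ≤ m → HasWeakDeriv D α u (g α)),
    (∑ k ∈ Finset.range (m + 1), ∑ α ∈ Finset.piAntidiag (Finset.univ : Finset (Fin d)) k,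
      ∫⁻ x in D, ‖ρ x ^ ((k : ℝ) - a) • g α x‖ₑ ^ p) ^ (1 / p)

/-- `u ∈ 𝒦^m_{a,p}(D)`. -/
def MemKondratiev {d : ℕ} (D : Set (Eucl d)) (ρ : Eucl d → ℝ) (m : ℕ) (a p : ℝ)
    (u : Eucl d → ℂ) : Prop :=
  kondratievNorm D ρ m a p u < ⊤

/-! ### Triebel-Lizorkin quasi-norms -/

/-- `φ₀` generates a smooth dyadic resolution of unity on `ℝ^d`. -/
def IsDyadicGenerator {d : ℕ} (φ₀ : 𝓢(Eucl d, ℂ)) : Prop :=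
  (∀ ξ, ‖ξ‖ ≤ 1 → φ₀ ξ = 1) ∧ ∀ ξ, 3 / 2 ≤ ‖ξ‖ → φ₀ ξ = 0

/-- The dyadic resolution of unity `φ_j` with `φ_0 = φ₀` and
`φ_j(ξ) = φ₀(2^{-j} ξ) - φ₀(2^{-j+1} ξ)` for `j ≥ 1`. -/
def dyadicFun {d : ℕ} (φ₀ : 𝓢(Eucl d, ℂ)) : ℕ → Eucl d → ℂ
  | 0, ξ => φ₀ ξ
  | j + 1, ξ => φ₀ (((2 : ℝ) ^ (j + 1))⁻¹ • ξ) - φ₀ (((2 : ℝ) ^ j)⁻¹ • ξ)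

/-- The Littlewood-Paley block `ℱ⁻¹(φ_j ℱ g)` of an integrable function `g`. -/
def lpBlock {d : ℕ} (φ₀ : 𝓢(Eucl d, ℂ)) (j : ℕ) (g : Eucl d → ℂ) : Eucl d → ℂ :=
  𝓕⁻ fun ξ => dyadicFun φ₀ j ξ * 𝓕 g ξ

/-- The quasi-norm of an integrable function `g` in `F^s_{p,q}(ℝ^d)`, for `0 < p, q < ∞`. -/
def triebelLizorkinNorm {d : ℕ} (φ₀ : 𝓢(Eucl d, ℂ)) (s p q : ℝ) (g : Eucl d → ℂ) : ℝ≥0∞ :=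
  (∫⁻ x, (∑' j : ℕ, (ENNReal.ofReal ((2 : ℝ) ^ ((j : ℝ) * s)) * ‖lpBlock φ₀ j g x‖ₑ) ^ q)
    ^ (p / q)) ^ (1 / p)

/-! ### Refined localization spaces -/

/-- The open dyadic cube `Q_{j,k} = 2^{-j}((0,1)^d + k)`; the index is `i = (j, k)`. -/
def dyadicCube {d : ℕ} (i : ℕ × (Fin d → ℤ)) : Set (Eucl d) :=
  {x | ∀ n, ((2 : ℝ) ^ i.1)⁻¹ * i.2 n < x n ∧ x n < ((2 : ℝ) ^ i.1)⁻¹ * (i.2 n + 1)}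

/-- The open cube `2 Q_{j,k}`, concentric with `Q_{j,k}` and of twice its side length. -/
def doubleCube {d : ℕ} (i : ℕ × (Fin d → ℤ)) : Set (Eucl d) :=
  {x | ∀ n, |x n - ((2 : ℝ) ^ i.1)⁻¹ * (i.2 n + 1 / 2)| < ((2 : ℝ) ^ i.1)⁻¹}

/-- The cubes `Q_{j,k}`, `(j, k) ∈ W`, are a Whitney decomposition of `D`: they are pairwise
disjoint, `D` is the union of their closures, `dist(2Q_{j,k}, ∂D) ∼ 2^{-j}` for `j ≥ 1`, and
`dist(2Q_{0,k}, ∂D)` is bounded from below. -/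
structure IsWhitneyDecomposition {d : ℕ} (D : Set (Eucl d)) (W : Set (ℕ × (Fin d → ℤ))) :
    Prop where
  pairwiseDisjoint : W.PairwiseDisjoint dyadicCube
  union_eq : ⋃ i ∈ W, closure (dyadicCube i) = D
  lower : ∃ c : ℝ, 0 < c ∧ ∀ i ∈ W, ∀ x ∈ doubleCube i,
    c * ((2 : ℝ) ^ i.1)⁻¹ ≤ Metric.infDist x (frontier D)
  upper : ∃ C : ℝ, 0 < C ∧ ∀ i ∈ W, 1 ≤ i.1 → ∃ x ∈ doubleCube i,
    Metric.infDist x (frontier D) ≤ C * ((2 : ℝ) ^ i.1)⁻¹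

/-- `ψ` is a resolution of unity on `D` with respect to the cubes of `W`. -/
structure IsResolutionOfUnity {d : ℕ} (D : Set (Eucl d)) (W : Set (ℕ × (Fin d → ℤ)))
    (ψ : ℕ × (Fin d → ℤ) → Eucl d → ℝ) : Prop where
  nonneg : ∀ i ∈ W, ∀ x, 0 ≤ ψ i x
  contDiff : ∀ i ∈ W, ContDiff ℝ ∞ (ψ i)
  tsupport_subset : ∀ i ∈ W, tsupport (ψ i) ⊆ doubleCube i
  hasSum_one : ∀ x ∈ D, HasSum (fun i : W => ψ i x) 1
  deriv_le : ∀ α : Fin d → ℕ, ∃ c : ℝ, ∀ i ∈ W, ∀ x,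
    |partialDeriv α (ψ i) x| ≤ c * (2 : ℝ) ^ (i.1 * ∑ n, α n)

/-- The quasi-norm in `F^{s,rloc}_{p,q}(D)` given by the Whitney decomposition `W`, the resolution
of unity `ψ` and the dyadic resolution generated by `φ₀`. The usual restriction
`s > d (1 / min(1, p, q) - 1)` is not imposed, as the formula makes sense without it. -/
def rlocNorm {d : ℕ} (W : Set (ℕ × (Fin d → ℤ))) (ψ : ℕ × (Fin d → ℤ) → Eucl d → ℝ)
    (φ₀ : 𝓢(Eucl d, ℂ)) (s p q : ℝ) (f : Eucl d → ℂ) : ℝ≥0∞ :=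
  (∑' i : W, triebelLizorkinNorm φ₀ s p q (fun x => ψ i x • f x) ^ p) ^ (1 / p)

/-- `f ∈ F^{s,rloc}_{p,q}(D)`. -/
def MemRloc {d : ℕ} (D : Set (Eucl d)) (W : Set (ℕ × (Fin d → ℤ)))
    (ψ : ℕ × (Fin d → ℤ) → Eucl d → ℝ) (φ₀ : 𝓢(Eucl d, ℂ)) (s p q : ℝ) (f : Eucl d → ℂ) : Prop :=
  LocallyIntegrableOn f D ∧ rlocNorm W ψ φ₀ s p q f < ⊤

/-- The continuous embedding `𝒦^m_{a,p}(D) ↪ F^{m,rloc}_{τ,2}(D)`. -/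
def KondratievEmbedsRloc {d : ℕ} (D : Set (Eucl d)) (ρ : Eucl d → ℝ) (m : ℕ) (a p τ : ℝ)
    (W : Set (ℕ × (Fin d → ℤ))) (ψ : ℕ × (Fin d → ℤ) → Eucl d → ℝ) (φ₀ : 𝓢(Eucl d, ℂ)) : Prop :=
  ∃ C : ℝ≥0, ∀ u : Eucl d → ℂ, MemKondratiev D ρ m a p u →
    MemRloc D W ψ φ₀ m τ 2 u ∧ rlocNorm W ψ φ₀ m τ 2 u ≤ C * kondratievNorm D ρ m a p u

end

/-!
Both embeddings are violated by sums of bumps. In the coordinates at an edge point, place in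
generation `n` about `R ^ (n δ)` balls of radius `r ∼ R ^ (-n)` over a lattice in the edge, at
distance `∼ r` from it, with `R` so large that balls of different generations do not interact. For
a sum of bumps with amplitudes `A b` on these balls, scaling gives
`‖u | 𝒦^m_{a,p}‖ ^ p ≲ ∑ b, A b ^ p * r b ^ (d - a p)` and
`‖ρ ^ (-m) u | L_τ‖ ^ τ ≳ ∑ b, A b ^ τ * r b ^ (d - m τ)`.
With `A = r ^ (a - (d - δ) / p) * (n + 1) ^ (-1 / τ)` the sum over a generation is
`∼ (n + 1) ^ (-p / τ)` in the first case and, by the assumption on the exponents,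
`≳ (n + 1) ^ (-1)` in the second.

For the refined localization norm, shrink the balls by a small factor and keep those of the family
so far apart that no Whitney cube meets two of them. On a cube of side length `2 ^ (-j)` meeting
the bump around `x`, the localized function `g = ψ_{j,k} u` then has such a small `L_1` norm that
the low frequencies `∑_{i ≤ j} ℱ⁻¹(φ_i ℱ g)`, which are bounded by a multiple of `2 ^ (j d) ‖g‖₁`,
account for at most half of `|g|` wherever the bump equals `1` and `ψ_{j,k}` is bounded from below.
There the remaining frequencies make the Littlewood-Paley function `≳ 2 ^ (j s) |g|`, so that the
norm is again bounded from below by the second sum.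
-/

noncomputable section

/-! ### Weak derivatives of smooth functions -/

section IntegrationByParts

open LineDeriv
open scoped LineDeriv

variable {E : Type*} [NormedAddCommGroup E] [NormedSpace ℝ E]

theorem schwartz_lineDerivOp_comm {F : Type*} [NormedAddCommGroup F] [NormedSpace ℝ F]
    (f : 𝓢(E, F)) (v w : E) : ∂_{v} (∂_{w} f) = ∂_{w} (∂_{v} f) := by
  have second (v w : E) (x : E) : ∂_{v} (∂_{w} f) x = fderiv ℝ (fderiv ℝ f) x v w := by
    exact (SchwartzMap.iteratedLineDerivOp_eq_iteratedFDeriv (m := ![v, w])).trans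
      (iteratedFDeriv_two_apply f x ![v, w])
  ext x
  rw [second, second]
  exact (f.smooth 2).contDiffAt.isSymmSndFDerivAt (by simp) v w

theorem schwartz_iteratedLineDerivOp_lineDerivOp_comm {F : Type*} [NormedAddCommGroup F]
    [NormedSpace ℝ F] (f : 𝓢(E, F)) {n : ℕ} (m : Fin n → E) (v : E) :
    ∂^{m} (∂_{v} f) = ∂_{v} (∂^{m} f) := by
  induction n with
  | zero => rfl
  | succ n ih =>
    rw [iteratedLineDerivOp_succ_left, ih, schwartz_lineDerivOp_comm,
      ← iteratedLineDerivOp_succ_left]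

theorem integral_iteratedLineDerivOp_mul [FiniteDimensional ℝ E] [MeasurableSpace E]
    [BorelSpace E] (μ : Measure E) [μ.IsAddHaarMeasure] (f g : 𝓢(E, ℝ)) {n : ℕ}
    (m : Fin n → E) : ∫ x, ∂^{m} f x * g x ∂μ = (-1) ^ n * ∫ x, f x * ∂^{m} g x ∂μ := by
  induction n generalizing g with
  | zero => simp
  | succ n ih =>
    calc ∫ x, ∂^{m} f x * g x ∂μ
        = -∫ x, ∂^{Fin.tail m} f x * ∂_{m 0} g x ∂μ := by
          rw [SchwartzMap.integral_mul_lineDerivOp_right_eq_neg_left, neg_neg,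
            iteratedLineDerivOp_succ_left]
      _ = -((-1) ^ n * ∫ x, f x * ∂^{Fin.tail m} (∂_{m 0} g) x ∂μ) := by rw [ih]
      _ = (-1) ^ (n + 1) * ∫ x, f x * ∂^{m} g x ∂μ := by
          rw [schwartz_iteratedLineDerivOp_lineDerivOp_comm, ← iteratedLineDerivOp_succ_left]
          ring

end IntegrationByParts

theorem exists_contDiff_hasCompactSupport_eventuallyEq {E F : Type*} [NormedAddCommGroup E]
    [NormedSpace ℝ E] [FiniteDimensional ℝ E] [NormedAddCommGroup F] [NormedSpace ℝ F]
    {U K : Set E} (hU : IsOpen U) (hK : IsCompact K) (hKU : K ⊆ U) {f : E → F}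
    (hf : ContDiffOn ℝ ∞ f U) :
    ∃ g : E → F, ContDiff ℝ ∞ g ∧ HasCompactSupport g ∧ ∀ x ∈ K, g =ᶠ[nhds x] f := by
  obtain ⟨L, hL, hKL, hLU⟩ := exists_compact_between hK hU hKU
  obtain ⟨χ, hχ1, hχ0, -⟩ := exists_contMDiffMap_one_nhds_of_subset_interior (n := (⊤ : ℕ∞))
    (modelWithCornersSelf ℝ E) hK.isClosed hKL
  have hχL : tsupport χ ⊆ L := hL.isClosed.closure_subset_iff.2 (Function.support_subset_iff'.2 hχ0)
  have hχf : tsupport (fun x => χ x • f x) ⊆ L := (tsupport_smul_subset_left _ _).trans hχL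
  refine ⟨fun x => χ x • f x, contMDiff_iff_contDiff.1 (contMDiff_of_tsupport fun x hx => ?_),
    hL.of_isClosed_subset (isClosed_tsupport _) hχf, fun x hx => ?_⟩
  · exact (χ.contMDiff.contDiff.contDiffAt.smul
      (hf.contDiffAt (hU.mem_nhds (hLU (hχf hx))))).contMDiffAt
  · filter_upwards [eventually_nhdsSet_iff_forall.1 hχ1 x hx] with y hy
    rw [hy, one_smul]

section PartialDeriv

variable {d : ℕ} {α : Fin d → ℕ} {f g : Eucl d → ℝ} {D : Set (Eucl d)}

theorem length_directions (α : Fin d → ℕ) : (directions α).length = ∑ i, α i := by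
  simp [directions, List.length_flatMap, Fin.sum_univ_def]

theorem support_partialDeriv_subset (α : Fin d → ℕ) (f : Eucl d → ℝ) :
    Function.support (partialDeriv α f) ⊆ tsupport f := fun x hx =>
  support_iteratedFDeriv_subset (𝕜 := ℝ) (directions α).length fun h =>
    hx (by simp [partialDeriv, h])

theorem abs_partialDeriv_le (α : Fin d → ℕ) (f : Eucl d → ℝ) (x : Eucl d) :
    |partialDeriv α f x| ≤ ‖iteratedFDeriv ℝ (∑ i, α i) f x‖ := by
  rw [← length_directions α]
  refine ((iteratedFDeriv ℝ (directions α).length f x).le_opNorm _).trans ?_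
  simp

theorem partialDeriv_congr {x : Eucl d} (h : f =ᶠ[nhds x] g) :
    partialDeriv α f x = partialDeriv α g x := by
  rw [partialDeriv, partialDeriv, (h.iteratedFDeriv ℝ _).eq_of_nhds]

theorem partialDeriv_const_mul {x : Eucl d} (hf : ContDiffAt ℝ ∞ f x) (c : ℝ) :
    partialDeriv α (fun y => c * f y) x = c * partialDeriv α f x := by
  simp only [partialDeriv, ← smul_eq_mul]
  rw [iteratedFDeriv_const_smul_apply' (hf.of_le (mod_cast le_top))]
  rfl

theorem continuousOn_partialDeriv (hD : IsOpen D) (hf : ContDiffOn ℝ ∞ f D) :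
    ContinuousOn (partialDeriv α f) D := fun x hx => by
  have h : ContinuousAt (iteratedFDeriv ℝ (directions α).length f) x :=
    ((hf.contDiffAt (hD.mem_nhds hx)).iteratedFDeriv_right (m := 0)
      (by norm_cast; exact le_top)).continuousAt
  exact ((ContinuousMultilinearMap.apply ℝ (fun _ => Eucl d) ℝ _).continuous.continuousAt.comp
    h).continuousWithinAt

theorem integral_partialDeriv_mul {θ : Eucl d → ℝ} (hθ : ContDiff ℝ ∞ θ)
    (hθc : HasCompactSupport θ) (hf : ContDiff ℝ ∞ f) (hfc : HasCompactSupport f) :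
    ∫ x, partialDeriv α θ x * f x = (-1) ^ (∑ i, α i) * ∫ x, θ x * partialDeriv α f x := by
  rw [← length_directions α]
  have h := integral_iteratedLineDerivOp_mul volume (hθc.toSchwartzMap hθ) (hfc.toSchwartzMap hf)
    fun i => EuclideanSpace.single ((directions α).get i) (1 : ℝ)
  simp only [SchwartzMap.iteratedLineDerivOp_eq_iteratedFDeriv] at h
  exact h

theorem hasWeakDeriv_partialDeriv (hD : IsOpen D) (hf : ContDiffOn ℝ ∞ f D) (α : Fin d → ℕ) :
    HasWeakDeriv D α (fun x => (f x : ℂ)) fun x => (partialDeriv α f x : ℂ) := by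
  have hloc {h : Eucl d → ℝ} (hh : ContinuousOn h D) :
      LocallyIntegrableOn (fun x => (h x : ℂ)) D :=
    (Complex.continuous_ofReal.comp_continuousOn hh).locallyIntegrableOn hD.measurableSet
  refine ⟨hloc hf.continuousOn, hloc (continuousOn_partialDeriv hD hf), fun θ hθ hθc hθD => ?_⟩
  obtain ⟨g, hg, hgc, hgf⟩ := exists_contDiff_hasCompactSupport_eventuallyEq hD hθc hθD hf
  have hsupp {η h h' : Eucl d → ℝ} (hη : Function.support η ⊆ tsupport θ)
      (hh : ∀ x ∈ tsupport θ, h x = h' x) :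
      ∫ x in D, η x • (h x : ℂ) = ((∫ x, η x * h' x : ℝ) : ℂ) := by
    rw [setIntegral_eq_integral_of_forall_compl_eq_zero, ← integral_complex_ofReal]
    · refine integral_congr_ae (.of_forall fun x => ?_)
      by_cases hx : x ∈ tsupport θ
      · simp [hh x hx]
      · simp [Function.notMem_support.1 fun h => hx (hη h)]
    · intro x hx
      rw [Function.notMem_support.1 fun h => hx (hθD (hη h)), zero_smul]
  rw [hsupp (support_partialDeriv_subset α θ) fun x hx => (hgf x hx).eq_of_nhds.symm,
    hsupp (subset_tsupport θ) fun x hx => (partialDeriv_congr (hgf x hx)).symm,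
    integral_partialDeriv_mul hθ hθc hg hgc]
  simp

end PartialDeriv

/-! ### A lower bound for Littlewood-Paley functions -/

/-- The projection `ℱ⁻¹(φ₀(2^{-j} ·) ℱ g)` of `g` onto frequencies of size at most about `2^j`. -/
def lowFreq {d : ℕ} (φ₀ : 𝓢(Eucl d, ℂ)) (j : ℕ) (g : Eucl d → ℂ) : Eucl d → ℂ :=
  𝓕⁻ fun ξ => φ₀ (((2 : ℝ) ^ j)⁻¹ • ξ) * 𝓕 g ξ

/-- The Littlewood-Paley function of order `s` with summation exponent `q`, whose `L_p` quasi-norm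
is the quasi-norm in `F^s_{p,q}`. -/
def littlewoodPaleyFun {d : ℕ} (φ₀ : 𝓢(Eucl d, ℂ)) (s q : ℝ) (g : Eucl d → ℂ) (y : Eucl d) :
    ℝ≥0∞ :=
  (∑' j : ℕ, (ENNReal.ofReal ((2 : ℝ) ^ ((j : ℝ) * s)) * ‖lpBlock φ₀ j g y‖ₑ) ^ q) ^ (1 / q)

section LittlewoodPaley

variable {d : ℕ} (φ₀ g : 𝓢(Eucl d, ℂ))

theorem hasTemperateGrowth_dilation (t : ℝ) : (fun ξ => φ₀ (t • ξ)).HasTemperateGrowth :=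
  φ₀.hasTemperateGrowth.comp (t • ContinuousLinearMap.id ℝ (Eucl d)).hasTemperateGrowth

theorem hasTemperateGrowth_dyadicFun (j : ℕ) : (dyadicFun φ₀ j).HasTemperateGrowth := by
  cases j with
  | zero => exact φ₀.hasTemperateGrowth
  | succ j => exact (hasTemperateGrowth_dilation φ₀ _).sub (hasTemperateGrowth_dilation φ₀ _)

theorem sum_range_succ_dyadicFun (j : ℕ) (ξ : Eucl d) :
    ∑ l ∈ Finset.range (j + 1), dyadicFun φ₀ l ξ = φ₀ (((2 : ℝ) ^ j)⁻¹ • ξ) := by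
  rw [Finset.sum_range_succ']
  simp only [dyadicFun]
  rw [Finset.sum_range_sub fun l => φ₀ (((2 : ℝ) ^ l)⁻¹ • ξ)]
  simp

theorem lpBlock_eq_fourierMultiplierCLM (j : ℕ) :
    lpBlock φ₀ j g = SchwartzMap.fourierMultiplierCLM ℂ (dyadicFun φ₀ j) g := by
  rw [SchwartzMap.fourierMultiplierCLM_apply, SchwartzMap.fourierInv_coe,
    SchwartzMap.smulLeftCLM_apply (hasTemperateGrowth_dyadicFun φ₀ j)]
  rfl

theorem lowFreq_eq_fourierMultiplierCLM (j : ℕ) :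
    lowFreq φ₀ j g =
      SchwartzMap.fourierMultiplierCLM ℂ (fun ξ => φ₀ (((2 : ℝ) ^ j)⁻¹ • ξ)) g := by
  rw [SchwartzMap.fourierMultiplierCLM_apply, SchwartzMap.fourierInv_coe,
    SchwartzMap.smulLeftCLM_apply (hasTemperateGrowth_dilation φ₀ _)]
  rfl

theorem lowFreq_eq_sum_lpBlock (j : ℕ) (y : Eucl d) :
    lowFreq φ₀ j g y = ∑ l ∈ Finset.range (j + 1), lpBlock φ₀ l g y := by
  simp_rw [lowFreq_eq_fourierMultiplierCLM, ← sum_range_succ_dyadicFun,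
    SchwartzMap.fourierMultiplierCLM_sum ℂ fun l _ => hasTemperateGrowth_dyadicFun φ₀ l,
    lpBlock_eq_fourierMultiplierCLM]
  simp

theorem measurable_littlewoodPaleyFun (s q : ℝ) : Measurable (littlewoodPaleyFun φ₀ s q g) := by
  refine Measurable.pow_const (Measurable.tsum fun l => Measurable.pow_const ?_ _) _
  rw [lpBlock_eq_fourierMultiplierCLM]
  exact (SchwartzMap.continuous _).measurable.enorm.const_mul _

theorem triebelLizorkinNorm_rpow (s q : ℝ) {p : ℝ} (hp : p ≠ 0) (f : Eucl d → ℂ) :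
    triebelLizorkinNorm φ₀ s p q f ^ p = ∫⁻ y, littlewoodPaleyFun φ₀ s q f y ^ p := by
  rw [triebelLizorkinNorm, ← ENNReal.rpow_mul, one_div_mul_cancel hp, ENNReal.rpow_one]
  simp_rw [littlewoodPaleyFun, ← ENNReal.rpow_mul, one_div_mul_eq_div]

theorem norm_fourierInv_le_integral (f : Eucl d → ℂ) (y : Eucl d) : ‖𝓕⁻ f y‖ ≤ ∫ v, ‖f v‖ := by
  rw [Real.fourierInv_eq]
  simpa using norm_integral_le_integral_norm fun v => Real.fourierChar (inner ℝ v y) • f v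

theorem norm_lowFreq_le (j : ℕ) (y : Eucl d) :
    ‖lowFreq φ₀ j g y‖ ≤ ((2 : ℝ) ^ j) ^ d * (∫ ξ, ‖φ₀ ξ‖) * ∫ v, ‖g v‖ := by
  have hφ₀ : Integrable fun ξ => ‖φ₀ (((2 : ℝ) ^ j)⁻¹ • ξ)‖ :=
    (φ₀.integrable.comp_smul (by positivity)).norm
  have hg (ξ : Eucl d) : ‖𝓕 (g : Eucl d → ℂ) ξ‖ ≤ ∫ v, ‖g v‖ := by
    rw [← SchwartzMap.fourier_coe, ← SchwartzMap.norm_toLp_one]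
    exact SchwartzMap.norm_fourier_apply_le_toLp_one g ξ
  calc ‖lowFreq φ₀ j g y‖
      ≤ ∫ ξ, ‖φ₀ (((2 : ℝ) ^ j)⁻¹ • ξ) * 𝓕 (g : Eucl d → ℂ) ξ‖ := norm_fourierInv_le_integral _ y
    _ ≤ ∫ ξ, ‖φ₀ (((2 : ℝ) ^ j)⁻¹ • ξ)‖ * ∫ v, ‖g v‖ := by
        refine integral_mono_of_nonneg (.of_forall fun _ => norm_nonneg _) (hφ₀.mul_const _)
          (.of_forall fun ξ => ?_)
        beta_reduce
        rw [norm_mul]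
        gcongr
        exact hg ξ
    _ = ((2 : ℝ) ^ j) ^ d * (∫ ξ, ‖φ₀ ξ‖) * ∫ v, ‖g v‖ := by
        rw [integral_mul_const, Measure.integral_comp_smul volume fun ξ => ‖φ₀ ξ‖,
          finrank_euclideanSpace_fin, inv_pow, inv_inv, abs_of_nonneg (by positivity), smul_eq_mul]

theorem tendsto_lowFreq (hφ₀ : φ₀ 0 = 1) (y : Eucl d) :
    Filter.Tendsto (fun j => lowFreq φ₀ j g y) Filter.atTop (nhds (g y)) := by
  obtain ⟨M, -, hM⟩ := φ₀.decay 0 0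
  have hinv : g y = 𝓕⁻ (𝓕 (g : Eucl d → ℂ)) y := by
    rw [g.continuous.fourierInv_fourier_eq g.integrable (𝓕 g).integrable]
  rw [hinv]
  simp_rw [lowFreq, Real.fourierInv_eq]
  refine tendsto_integral_of_dominated_convergence (fun ξ => M * ‖𝓕 (g : Eucl d → ℂ) ξ‖)
    (fun j => ?_) ((𝓕 g).integrable.norm.const_mul M) (fun j => .of_forall fun ξ => ?_)
    (.of_forall fun ξ => ?_)
  · have : Continuous (𝓕 (g : Eucl d → ℂ)) := (𝓕 g).continuous
    exact Continuous.aestronglyMeasurable (by fun_prop)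
  · rw [Circle.norm_smul, norm_mul]
    gcongr
    simpa using hM (((2 : ℝ) ^ j)⁻¹ • ξ)
  · have hscale : Filter.Tendsto (fun j : ℕ => ((2 : ℝ) ^ j)⁻¹ • ξ) Filter.atTop (nhds 0) := by
      simpa using (tendsto_inv_atTop_zero.comp
        (tendsto_pow_atTop_atTop_of_one_lt (one_lt_two (α := ℝ)))).smul_const ξ
    simpa [hφ₀] using (((φ₀.continuous.tendsto 0).comp hscale).mul_const
      (𝓕 (g : Eucl d → ℂ) ξ)).const_smul (Real.fourierChar (inner ℝ ξ y))

theorem enorm_lpBlock_le {s q : ℝ} (hq : 0 < q) (j : ℕ) (f : Eucl d → ℂ) (y : Eucl d) :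
    ‖lpBlock φ₀ j f y‖ₑ ≤
      ENNReal.ofReal ((2 : ℝ) ^ (-((j : ℝ) * s))) * littlewoodPaleyFun φ₀ s q f y := by
  have hterm : ENNReal.ofReal ((2 : ℝ) ^ ((j : ℝ) * s)) * ‖lpBlock φ₀ j f y‖ₑ ≤
      littlewoodPaleyFun φ₀ s q f y := by
    rw [littlewoodPaleyFun, one_div, ENNReal.le_rpow_inv_iff hq]
    exact ENNReal.le_tsum (f := fun l : ℕ =>
      (ENNReal.ofReal ((2 : ℝ) ^ ((l : ℝ) * s)) * ‖lpBlock φ₀ l f y‖ₑ) ^ q) j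
  calc ‖lpBlock φ₀ j f y‖ₑ = ENNReal.ofReal ((2 : ℝ) ^ (-((j : ℝ) * s))) *
        (ENNReal.ofReal ((2 : ℝ) ^ ((j : ℝ) * s)) * ‖lpBlock φ₀ j f y‖ₑ) := by
        rw [← mul_assoc, ← ENNReal.ofReal_mul (by positivity), ← Real.rpow_add two_pos,
          neg_add_cancel, Real.rpow_zero, ENNReal.ofReal_one, one_mul]
    _ ≤ _ := by gcongr

theorem enorm_sub_lowFreq_le (hφ₀ : φ₀ 0 = 1) {s q : ℝ} (hs : 1 ≤ s) (hq : 0 < q) (j : ℕ)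
    (y : Eucl d) : ‖g y - lowFreq φ₀ j g y‖ₑ ≤
      ENNReal.ofReal ((2 : ℝ) ^ (-((j : ℝ) * s))) * littlewoodPaleyFun φ₀ s q g y := by
  set P := littlewoodPaleyFun φ₀ s q g y
  set w := ENNReal.ofReal ((2 : ℝ) ^ (-((j : ℝ) * s)))
  have hterm (l : ℕ) : ‖lpBlock φ₀ (j + 1 + l) g y‖ₑ ≤ 2⁻¹ ^ (l + 1) * (w * P) := by
    refine (enorm_lpBlock_le φ₀ (s := s) hq _ _ y).trans ?_
    rw [← mul_assoc]
    gcongr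
    rw [← ENNReal.ofReal_ofNat 2, ← ENNReal.ofReal_inv_of_pos two_pos,
      ← ENNReal.ofReal_pow (by positivity), ← ENNReal.ofReal_mul (by positivity), inv_pow,
      ← Real.rpow_natCast, ← Real.rpow_neg two_pos.le,
      ← Real.rpow_add two_pos]
    gcongr
    · exact one_le_two
    · push_cast
      nlinarith
  have hpartial (n : ℕ) : ‖lowFreq φ₀ (j + n) g y - lowFreq φ₀ j g y‖ₑ ≤ w * P := by
    calc ‖lowFreq φ₀ (j + n) g y - lowFreq φ₀ j g y‖ₑ
        = ‖∑ l ∈ Finset.range n, lpBlock φ₀ (j + 1 + l) g y‖ₑ := by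
          rw [lowFreq_eq_sum_lpBlock, lowFreq_eq_sum_lpBlock, add_right_comm,
            Finset.sum_range_add, add_sub_cancel_left]
      _ ≤ ∑ l ∈ Finset.range n, 2⁻¹ ^ (l + 1) * (w * P) :=
          (enorm_sum_le _ _).trans (Finset.sum_le_sum fun l _ => hterm l)
      _ ≤ ∑' l, 2⁻¹ ^ (l + 1) * (w * P) := ENNReal.sum_le_tsum _
      _ = w * P := by
          rw [ENNReal.tsum_mul_right, ENNReal.tsum_geometric_add_one, ENNReal.one_sub_inv_two,
            inv_inv, ENNReal.inv_mul_cancel (by simp) (by simp), one_mul]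
  have hlim := ((tendsto_lowFreq φ₀ g hφ₀ y).comp (Filter.tendsto_add_atTop_nat j)).sub_const
    (lowFreq φ₀ j g y)
  refine le_of_tendsto hlim.enorm (.of_forall fun n => ?_)
  rw [Function.comp_apply, add_comm]
  exact hpartial n

end LittlewoodPaley

/-! ### Separated balls accumulating at a set -/

/-- The closed balls with centres `x b` and radii `r b` are separated from one another, their
doubles lie in `D`, their radii are comparable to the distances to `S`, and only finitely many of
them have radii bounded from below. -/
structure IsSeparatedBalls {X ι : Type*} [PseudoMetricSpace X] (D S : Set X) (x : ι → X)
    (r : ι → ℝ) (C : ℝ) : Prop where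
  pos : ∀ b, 0 < r b
  ball_subset : ∀ b, Metric.ball (x b) (2 * r b) ⊆ D
  exists_dist_le : ∀ b, ∃ z ∈ S, dist (x b) z ≤ C * r b
  add_lt_dist : ∀ b b', b ≠ b' → r b + r b' < dist (x b) (x b')
  finite : ∀ t, 0 < t → {b | t ≤ r b}.Finite

/-- Any two of the balls with centres `x b` and radii `r b` are at a distance greater than `B` times
the smaller one of their radii. For large `B`, no Whitney cube meets two of the balls. -/
def HasRelativeGap {X ι : Type*} [PseudoMetricSpace X] (x : ι → X) (r : ι → ℝ) (B : ℝ) : Prop :=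
  ∀ b b', b ≠ b' → r b + r b' + B * min (r b) (r b') < dist (x b) (x b')

namespace IsSeparatedBalls

variable {X ι : Type*} [PseudoMetricSpace X] {D S : Set X} {x : ι → X} {r : ι → ℝ} {C : ℝ}

theorem closedBall_subset (h : IsSeparatedBalls D S x r C) (b : ι) :
    Metric.closedBall (x b) (r b) ⊆ D :=
  (Metric.closedBall_subset_ball (by linarith [h.pos b])).trans (h.ball_subset b)

theorem closedBall_half_subset (h : IsSeparatedBalls D S x r C) (b : ι) :
    Metric.closedBall (x b) (1 / 2 * r b) ⊆ Metric.closedBall (x b) (r b) :=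
  Metric.closedBall_subset_closedBall (by linarith [h.pos b])

theorem pairwise_disjoint_closedBall (h : IsSeparatedBalls D S x r C) :
    Pairwise (Function.onFun Disjoint fun b => Metric.closedBall (x b) (r b)) :=
  fun _ _ hne => Metric.closedBall_disjoint_closedBall (h.add_lt_dist _ _ hne)

theorem eq_of_mem_closedBall (h : IsSeparatedBalls D S x r C) {y : X} {b b' : ι}
    (hb : y ∈ Metric.closedBall (x b) (r b)) (hb' : y ∈ Metric.closedBall (x b') (r b')) :
    b = b' := by
  by_contra hne
  exact (h.pairwise_disjoint_closedBall hne).le_bot ⟨hb, hb'⟩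

theorem exists_dist_le_of_mem (h : IsSeparatedBalls D S x r C) {y : X} {b : ι}
    (hb : y ∈ Metric.closedBall (x b) (r b)) : ∃ z ∈ S, dist y z ≤ (C + 1) * r b := by
  obtain ⟨z, hz, hxz⟩ := h.exists_dist_le b
  rw [Metric.mem_closedBall] at hb
  exact ⟨z, hz, by linarith [dist_triangle y (x b) z]⟩

theorem infDist_le (h : IsSeparatedBalls D S x r C) {y : X} {b : ι}
    (hb : y ∈ Metric.closedBall (x b) (r b)) : Metric.infDist y S ≤ (C + 1) * r b := by
  obtain ⟨z, hz, hyz⟩ := h.exists_dist_le_of_mem hb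
  exact (Metric.infDist_le_dist_of_mem hz).trans hyz

theorem le_infDist (h : IsSeparatedBalls D S x r C) {T : Set X} (hT : T.Nonempty)
    (hTD : Disjoint T D) {y : X} {b : ι} (hb : y ∈ Metric.closedBall (x b) (r b)) :
    r b ≤ Metric.infDist y T := by
  refine (Metric.le_infDist hT).2 fun z hz => le_of_not_gt fun hlt => ?_
  refine hTD.le_bot ⟨hz, h.ball_subset b ?_⟩
  rw [Metric.mem_closedBall] at hb
  rw [Metric.mem_ball]
  linarith [dist_triangle_left z (x b) y]

theorem eventually_mem_closedBall (h : IsSeparatedBalls D S x r C) (hD : IsOpen D)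
    (hSD : Disjoint S D) {y : X} (hy : y ∈ D) :
    ∀ᶠ z in nhds y, ∀ b, z ∈ Metric.closedBall (x b) (r b) → y ∈ Metric.closedBall (x b) (r b) := by
  obtain ⟨ε, hε, hball⟩ := Metric.isOpen_iff.1 hD y hy
  have hfin := h.finite (ε / 2 / (|C| + 1)) (by positivity)
  have hlarge : ∀ᶠ z in nhds y, ∀ b, z ∈ Metric.closedBall (x b) (r b) →
      ε / 2 / (|C| + 1) ≤ r b := by
    filter_upwards [Metric.ball_mem_nhds y (half_pos hε)] with z hz b hb
    obtain ⟨w, hw, hzw⟩ := h.exists_dist_le_of_mem hb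
    have hyw : ε ≤ dist w y := le_of_not_gt fun hlt => hSD.le_bot ⟨hw, hball hlt⟩
    rw [Metric.mem_ball] at hz
    rw [div_le_iff₀ (by positivity)]
    nlinarith [dist_triangle_left w y z, mul_le_mul_of_nonneg_right (le_abs_self C) (h.pos b).le]
  have hclosed : ∀ᶠ z in nhds y, ∀ b ∈ {b | ε / 2 / (|C| + 1) ≤ r b},
      z ∈ Metric.closedBall (x b) (r b) → y ∈ Metric.closedBall (x b) (r b) := by
    refine (Filter.eventually_all_finite hfin).2 fun b _ => ?_
    by_cases hyb : y ∈ Metric.closedBall (x b) (r b)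
    · exact .of_forall fun _ _ => hyb
    · filter_upwards [Metric.isClosed_closedBall.isOpen_compl.mem_nhds hyb] with z hz hzb
      exact absurd hzb hz
  filter_upwards [hlarge, hclosed] with z hz hz' b hb using hz' b (hz b hb) hb

theorem shrink (h : IsSeparatedBalls D S x r C) {ε : ℝ} (hε : 0 < ε) (hε1 : ε ≤ 1) :
    IsSeparatedBalls D S x (fun b => ε * r b) (C / ε) := by
  have hle (b : ι) : ε * r b ≤ r b := mul_le_of_le_one_left (h.pos b).le hε1
  refine ⟨fun b => mul_pos hε (h.pos b), fun b => ?_, fun b => ?_, fun b b' hne => ?_,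
    fun t ht => (h.finite t ht).subset fun b hb => le_trans hb (hle b)⟩
  · exact (Metric.ball_subset_ball (by linarith [hle b])).trans (h.ball_subset b)
  · obtain ⟨z, hz, hxz⟩ := h.exists_dist_le b
    exact ⟨z, hz, hxz.trans_eq (by field_simp)⟩
  · linarith [h.add_lt_dist b b' hne, hle b, hle b']

end IsSeparatedBalls

/-! ### Rescaled bump functions -/

/-- A bump function on the unit ball of `ℝ^d`, equal to `1` on the ball of radius `1 / 2`. -/
def unitBump (d : ℕ) : ContDiffBump (0 : Eucl d) := ⟨1 / 2, 1, by norm_num, by norm_num⟩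

/-- The bump function on the ball with centre `y` and radius `s`. -/
def scaledBump {d : ℕ} (y : Eucl d) (s : ℝ) (x : Eucl d) : ℝ := unitBump d (s⁻¹ • (x - y))

theorem contDiff_scaledBump {d : ℕ} (y : Eucl d) (s : ℝ) : ContDiff ℝ ∞ (scaledBump y s) :=
  (unitBump d).contDiff.comp (by fun_prop : ContDiff ℝ ∞ fun x => s⁻¹ • (x - y))

theorem scaledBump_nonneg {d : ℕ} (y : Eucl d) (s : ℝ) (x : Eucl d) : 0 ≤ scaledBump y s x :=
  (unitBump d).nonneg

theorem scaledBump_le_one {d : ℕ} (y : Eucl d) (s : ℝ) (x : Eucl d) : scaledBump y s x ≤ 1 :=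
  (unitBump d).le_one

theorem scaledBump_eq_one {d : ℕ} {y : Eucl d} {s : ℝ} (hs : 0 < s) {x : Eucl d}
    (hx : x ∈ Metric.closedBall y (1 / 2 * s)) : scaledBump y s x = 1 := by
  apply (unitBump d).one_of_mem_closedBall
  rw [mem_closedBall_zero_iff, norm_smul, norm_inv, Real.norm_of_nonneg hs.le, inv_mul_le_iff₀ hs]
  rw [Metric.mem_closedBall, dist_eq_norm] at hx
  change ‖x - y‖ ≤ s * (1 / 2)
  linarith

theorem tsupport_scaledBump_subset {d : ℕ} (y : Eucl d) {s : ℝ} (hs : 0 < s) :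
    tsupport (scaledBump y s) ⊆ Metric.closedBall y s := by
  refine closure_minimal ?_ Metric.isClosed_closedBall
  intro x hx
  by_contra hlt
  rw [Metric.mem_closedBall, not_le, dist_eq_norm] at hlt
  refine hx ((unitBump d).zero_of_le_dist ?_)
  rw [dist_zero_right, norm_smul, norm_inv, Real.norm_of_nonneg hs.le, le_inv_mul_iff₀ hs]
  change s * 1 ≤ _
  linarith

theorem hasCompactSupport_scaledBump {d : ℕ} (y : Eucl d) {s : ℝ} (hs : 0 < s) :
    HasCompactSupport (scaledBump y s) :=
  (isCompact_closedBall y s).of_isClosed_subset (isClosed_tsupport _)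
    (tsupport_scaledBump_subset y hs)

theorem exists_abs_partialDeriv_scaledBump_le (d k : ℕ) :
    ∃ M : ℝ, 0 < M ∧ ∀ (y : Eucl d) (s : ℝ), 0 < s → ∀ α : Fin d → ℕ, ∑ i, α i = k → ∀ x,
      |partialDeriv α (scaledBump y s) x| ≤ M * (s ^ k)⁻¹ := by
  have hsm : ContDiff ℝ ∞ (unitBump d : Eucl d → ℝ) := (unitBump d).contDiff
  have hcont : Continuous (iteratedFDeriv ℝ k (unitBump d : Eucl d → ℝ)) :=
    hsm.continuous_iteratedFDeriv (by norm_cast; exact le_top)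
  obtain ⟨M, hM⟩ := hcont.bounded_above_of_compact_support
    ((unitBump d).hasCompactSupport.iteratedFDeriv k)
  refine ⟨max M 1, by positivity, fun y s hs α hα x => ?_⟩
  refine (abs_partialDeriv_le α _ x).trans ?_
  rw [hα]
  have hcomp : iteratedFDeriv ℝ k (scaledBump y s) x =
      (s⁻¹) ^ k • iteratedFDeriv ℝ k (unitBump d : Eucl d → ℝ) (s⁻¹ • (x - y)) := by
    have := iteratedFDeriv_comp_sub (𝕜 := ℝ) (f := fun z : Eucl d => unitBump d (s⁻¹ • z)) k y x
    change iteratedFDeriv ℝ k (fun z : Eucl d => unitBump d (s⁻¹ • (z - y))) x = _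
    rw [this, iteratedFDeriv_comp_const_smul _ (hsm.of_le (by norm_cast; exact le_top))]
  rw [hcomp, norm_smul, norm_pow, norm_inv, Real.norm_of_nonneg hs.le, inv_pow, mul_comm]
  gcongr
  exact (hM _).trans (le_max_left _ _)

/-- The sum of the bumps `A b · η((y - x b) / r b)`, where `η` is `unitBump`. -/
def bumpSum {d : ℕ} {ι : Type*} (x : ι → Eucl d) (r A : ι → ℝ) (y : Eucl d) : ℝ :=
  ∑' b, A b * scaledBump (x b) (r b) y

namespace IsSeparatedBalls

variable {d : ℕ} {ι : Type*} {D S : Set (Eucl d)} {x : ι → Eucl d} {r : ι → ℝ} {C : ℝ}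

theorem scaledBump_eq_zero (h : IsSeparatedBalls D S x r C) {y : Eucl d} {b : ι}
    (hy : y ∉ Metric.closedBall (x b) (r b)) : scaledBump (x b) (r b) y = 0 :=
  image_eq_zero_of_notMem_tsupport fun hmem => hy (tsupport_scaledBump_subset _ (h.pos b) hmem)

theorem bumpSum_of_mem (h : IsSeparatedBalls D S x r C) (A : ι → ℝ) {y : Eucl d} {b : ι}
    (hb : y ∈ Metric.closedBall (x b) (r b)) :
    bumpSum x r A y = A b * scaledBump (x b) (r b) y :=
  tsum_eq_single b fun b' hne => by
    rw [h.scaledBump_eq_zero fun hb' => hne (h.eq_of_mem_closedBall hb' hb), mul_zero]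

theorem bumpSum_of_mem_half (h : IsSeparatedBalls D S x r C) (A : ι → ℝ) {y : Eucl d} {b : ι}
    (hb : y ∈ Metric.closedBall (x b) (1 / 2 * r b)) : bumpSum x r A y = A b := by
  have hy := h.closedBall_half_subset b hb
  rw [h.bumpSum_of_mem A hy, scaledBump_eq_one (h.pos b) hb, mul_one]

theorem bumpSum_of_forall_notMem (h : IsSeparatedBalls D S x r C) (A : ι → ℝ) {y : Eucl d}
    (hy : ∀ b, y ∉ Metric.closedBall (x b) (r b)) : bumpSum x r A y = 0 := by
  simp only [bumpSum, h.scaledBump_eq_zero (hy _), mul_zero, tsum_zero]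

theorem bumpSum_eventuallyEq_zero (h : IsSeparatedBalls D S x r C) (hD : IsOpen D)
    (hSD : Disjoint S D) (A : ι → ℝ) {y : Eucl d} (hyD : y ∈ D)
    (hy : ∀ b, y ∉ Metric.closedBall (x b) (r b)) : bumpSum x r A =ᶠ[nhds y] fun _ => 0 := by
  filter_upwards [h.eventually_mem_closedBall hD hSD hyD] with z hz
  exact h.bumpSum_of_forall_notMem A fun b hb => hy b (hz b hb)

theorem bumpSum_eventuallyEq (h : IsSeparatedBalls D S x r C) (hD : IsOpen D)
    (hSD : Disjoint S D) (A : ι → ℝ) {y : Eucl d} {b : ι}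
    (hb : y ∈ Metric.closedBall (x b) (r b)) :
    bumpSum x r A =ᶠ[nhds y] fun z => A b * scaledBump (x b) (r b) z := by
  filter_upwards [h.eventually_mem_closedBall hD hSD (h.closedBall_subset b hb)] with z hz
  by_cases hzb : z ∈ Metric.closedBall (x b) (r b)
  · exact h.bumpSum_of_mem A hzb
  · rw [h.scaledBump_eq_zero hzb, mul_zero]
    refine h.bumpSum_of_forall_notMem A fun b' hb' => hzb ?_
    rwa [h.eq_of_mem_closedBall hb (hz b' hb')]

theorem contDiffOn_bumpSum (h : IsSeparatedBalls D S x r C) (hD : IsOpen D) (hSD : Disjoint S D)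
    (A : ι → ℝ) : ContDiffOn ℝ ∞ (bumpSum x r A) D := by
  intro y hy
  refine ContDiffAt.contDiffWithinAt ?_
  by_cases hb : ∃ b, y ∈ Metric.closedBall (x b) (r b)
  · obtain ⟨b, hb⟩ := hb
    exact (contDiff_const.mul (contDiff_scaledBump _ _)).contDiffAt.congr_of_eventuallyEq
      (h.bumpSum_eventuallyEq hD hSD A hb)
  · exact contDiffAt_const.congr_of_eventuallyEq
      (h.bumpSum_eventuallyEq_zero hD hSD A hy (not_exists.1 hb))

theorem partialDeriv_bumpSum_of_mem (h : IsSeparatedBalls D S x r C) (hD : IsOpen D)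
    (hSD : Disjoint S D) (A : ι → ℝ) (α : Fin d → ℕ) {y : Eucl d} {b : ι}
    (hb : y ∈ Metric.closedBall (x b) (r b)) :
    partialDeriv α (bumpSum x r A) y = A b * partialDeriv α (scaledBump (x b) (r b)) y := by
  rw [partialDeriv_congr (h.bumpSum_eventuallyEq hD hSD A hb),
    partialDeriv_const_mul (contDiff_scaledBump _ _).contDiffAt]

theorem partialDeriv_bumpSum_of_forall_notMem (h : IsSeparatedBalls D S x r C) (hD : IsOpen D)
    (hSD : Disjoint S D) (A : ι → ℝ) (α : Fin d → ℕ) {y : Eucl d} (hyD : y ∈ D)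
    (hy : ∀ b, y ∉ Metric.closedBall (x b) (r b)) : partialDeriv α (bumpSum x r A) y = 0 := by
  by_contra hne
  refine notMem_tsupport_iff_eventuallyEq.2 (h.bumpSum_eventuallyEq_zero hD hSD A hyD hy)
    (support_partialDeriv_subset α _ hne)

end IsSeparatedBalls

/-! ### Sums of bumps over a separated family of balls -/

theorem tsum_mul_measure_le_lintegral {X ι : Type*} [MeasurableSpace X] [Countable ι]
    {μ : Measure X} {s : ι → Set X} (hs : ∀ b, MeasurableSet (s b))
    (hd : Pairwise (Function.onFun Disjoint s)) {L : ι → ℝ≥0∞} {h : X → ℝ≥0∞}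
    (hL : ∀ b, ∀ x ∈ s b, L b ≤ h x) : ∑' b, L b * μ (s b) ≤ ∫⁻ x, h x ∂μ := by
  calc ∑' b, L b * μ (s b) ≤ ∑' b, ∫⁻ x in s b, h x ∂μ := by
        refine ENNReal.tsum_le_tsum fun b => ?_
        rw [← setLIntegral_const]
        exact setLIntegral_mono' (hs b) (hL b)
    _ = ∫⁻ x in ⋃ b, s b, h x ∂μ := (lintegral_iUnion hs hd h).symm
    _ ≤ _ := setLIntegral_le_lintegral _ _

theorem lintegral_le_tsum_mul_measure {X ι : Type*} [MeasurableSpace X] [Countable ι]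
    {μ : Measure X} {s : ι → Set X} (hs : ∀ b, MeasurableSet (s b)) {L : ι → ℝ≥0∞} {h : X → ℝ≥0∞}
    (hL : ∀ b, ∀ x ∈ s b, h x ≤ L b) (h0 : ∀ x, (∀ b, x ∉ s b) → h x = 0) :
    ∫⁻ x, h x ∂μ ≤ ∑' b, L b * μ (s b) := by
  calc ∫⁻ x, h x ∂μ = ∫⁻ x in ⋃ b, s b, h x ∂μ := by
        rw [← lintegral_indicator (MeasurableSet.iUnion hs)]
        refine lintegral_congr fun x => ?_
        by_cases hx : x ∈ ⋃ b, s b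
        · rw [indicator_of_mem hx]
        · rw [indicator_of_notMem hx, h0 x (by simpa using hx)]
    _ ≤ ∑' b, ∫⁻ x in s b, h x ∂μ := lintegral_iUnion_le _ _
    _ ≤ _ := by
        refine ENNReal.tsum_le_tsum fun b => ?_
        rw [← setLIntegral_const]
        exact setLIntegral_mono' (hs b) (hL b)

theorem rpow_le_of_comparable {k₁ k₂ r t : ℝ} (hk₁ : 0 < k₁) (hr : 0 < r) (h1 : k₁ * r ≤ t)
    (h2 : t ≤ k₂ * r) (e : ℝ) : t ^ e ≤ (k₁ ^ e + k₂ ^ e) * r ^ e := by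
  have ht : 0 < t := (mul_pos hk₁ hr).trans_le h1
  have hk₂ : 0 < k₂ := pos_of_mul_pos_left (ht.trans_le h2) hr.le
  rw [add_mul, ← Real.mul_rpow hk₁.le hr.le, ← Real.mul_rpow hk₂.le hr.le]
  rcases le_total 0 e with he | he
  · have := Real.rpow_le_rpow ht.le h2 he
    linarith [Real.rpow_nonneg (mul_pos hk₁ hr).le e]
  · have := Real.rpow_le_rpow_of_nonpos (mul_pos hk₁ hr) h1 he
    linarith [Real.rpow_nonneg (mul_pos hk₂ hr).le e]

theorem le_rpow_of_comparable {k₁ k₂ r t : ℝ} (hk₁ : 0 < k₁) (hr : 0 < r) (h1 : k₁ * r ≤ t)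
    (h2 : t ≤ k₂ * r) (e : ℝ) : (k₁ ^ (-e) + k₂ ^ (-e))⁻¹ * r ^ e ≤ t ^ e := by
  have ht : 0 < t := (mul_pos hk₁ hr).trans_le h1
  have hk₂ : 0 < k₂ := pos_of_mul_pos_left (ht.trans_le h2) hr.le
  have h := rpow_le_of_comparable hk₁ hr h1 h2 (-e)
  rw [Real.rpow_neg ht.le, Real.rpow_neg hr.le, inv_le_iff_one_le_mul₀ (by positivity)] at h
  rw [inv_mul_le_iff₀ (by positivity)]
  calc r ^ e = r ^ e * 1 := by ring
    _ ≤ r ^ e * ((k₁ ^ (-e) + k₂ ^ (-e)) * (r ^ e)⁻¹ * t ^ e) := by gcongr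
    _ = _ := by field_simp

theorem volume_closedBall_eucl {d : ℕ} (y : Eucl d) {s : ℝ} (hs : 0 ≤ s) :
    volume (Metric.closedBall y s) =
      ENNReal.ofReal (s ^ d) * volume (Metric.closedBall (0 : Eucl d) 1) := by
  rw [Measure.addHaar_closedBall' volume y hs, finrank_euclideanSpace_fin]

theorem tsum_rpow_mul_volume {d : ℕ} {ι : Type*} {x : ι → Eucl d} {r A : ι → ℝ} {M ε : ℝ}
    (hr : ∀ b, 0 < r b) (hA : ∀ b, 0 ≤ A b) (hM : 0 ≤ M) (hε : 0 < ε) (e : ℝ) {q : ℝ} (hq : 0 ≤ q) :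
    ∑' b, ENNReal.ofReal (M * A b * r b ^ e) ^ q * volume (Metric.closedBall (x b) (ε * r b)) =
      ENNReal.ofReal (M ^ q * ε ^ d) * volume (Metric.closedBall (0 : Eucl d) 1) *
        ∑' b, ENNReal.ofReal (A b ^ q * r b ^ (d + e * q)) := by
  rw [← ENNReal.tsum_mul_left]
  refine tsum_congr fun b => ?_
  have hrb := hr b
  have hAb := hA b
  rw [volume_closedBall_eucl _ (by positivity), ENNReal.ofReal_rpow_of_nonneg (by positivity) hq,
    ← mul_assoc, ← ENNReal.ofReal_mul (by positivity),
    mul_right_comm (ENNReal.ofReal (M ^ q * ε ^ d)),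
    ← ENNReal.ofReal_mul (by positivity)]
  congr 2
  rw [Real.mul_rpow (by positivity) (by positivity), Real.mul_rpow hM hAb, ← Real.rpow_mul hrb.le,
    Real.rpow_add hrb, Real.rpow_natCast, mul_pow]
  ring

namespace IsSeparatedBalls

variable {d : ℕ} {ι : Type*} {D S : Set (Eucl d)} {x : ι → Eucl d} {r A : ι → ℝ}
  {C k₁ k₂ : ℝ} {ρ : Eucl d → ℝ}

theorem lintegral_lt_top [Countable ι] (h : IsSeparatedBalls D S x r C) (hA : ∀ b, 0 ≤ A b)
    {M e q : ℝ} (hM : 0 ≤ M) (hq : 0 < q)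
    (hsum : ∑' b, ENNReal.ofReal (A b ^ q * r b ^ (d + e * q)) < ⊤) {g : Eucl d → ℝ≥0∞}
    (hg : ∀ b, ∀ y ∈ Metric.closedBall (x b) (r b), g y ≤ ENNReal.ofReal (M * A b * r b ^ e))
    (hg0 : ∀ y ∈ D, (∀ b, y ∉ Metric.closedBall (x b) (r b)) → g y = 0) (hD : MeasurableSet D) :
    ∫⁻ y in D, g y ^ q < ⊤ := by
  rw [← lintegral_indicator hD]
  refine (lintegral_le_tsum_mul_measure (s := fun b => Metric.closedBall (x b) (1 * r b))
    (L := fun b => ENNReal.ofReal (M * A b * r b ^ e) ^ q)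
    (fun b => Metric.isClosed_closedBall.measurableSet) (fun b y hy => ?_)
    fun y hy => ?_).trans_lt ?_
  · rw [one_mul] at hy
    exact (indicator_le_self _ _ y).trans (ENNReal.rpow_le_rpow (hg b y hy) hq.le)
  · simp only [one_mul] at hy
    refine indicator_apply_eq_zero.2 fun hyD => ?_
    rw [hg0 y hyD hy, ENNReal.zero_rpow_of_pos hq]
  · rw [tsum_rpow_mul_volume h.pos hA hM one_pos e hq.le]
    exact ENNReal.mul_lt_top (ENNReal.mul_lt_top ENNReal.ofReal_lt_top
      measure_closedBall_lt_top) hsum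

theorem lintegral_eq_top [Countable ι] (h : IsSeparatedBalls D S x r C) (hA : ∀ b, 0 ≤ A b)
    {M e q : ℝ} (hM : 0 < M) (hq : 0 ≤ q)
    (hsum : ∑' b, ENNReal.ofReal (A b ^ q * r b ^ (d + e * q)) = ⊤) {g : Eucl d → ℝ≥0∞}
    (hg : ∀ b, ∀ y ∈ Metric.closedBall (x b) (1 / 2 * r b),
      ENNReal.ofReal (M * A b * r b ^ e) ^ q ≤ g y) :
    ∫⁻ y in D, g y = ⊤ := by
  have hdisj : Pairwise (Function.onFun Disjoint fun b => Metric.closedBall (x b) (1 / 2 * r b)) :=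
    fun b b' hne => (h.pairwise_disjoint_closedBall hne).mono (h.closedBall_half_subset b)
      (h.closedBall_half_subset b')
  have hle := tsum_mul_measure_le_lintegral (μ := volume.restrict D)
    (fun b => Metric.isClosed_closedBall.measurableSet) hdisj hg
  have hvol (b : ι) : volume.restrict D (Metric.closedBall (x b) (1 / 2 * r b)) =
      volume (Metric.closedBall (x b) (1 / 2 * r b)) :=
    Measure.restrict_eq_self _ ((h.closedBall_half_subset b).trans (h.closedBall_subset b))
  refine top_le_iff.1 (le_of_eq_of_le ?_ hle)
  simp_rw [hvol]
  rw [tsum_rpow_mul_volume h.pos hA hM.le (by norm_num) e hq, hsum, ENNReal.mul_top]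
  exact mul_ne_zero (ENNReal.ofReal_pos.2 (by positivity)).ne'
    (Metric.measure_closedBall_pos _ _ one_pos).ne'

theorem exists_enorm_rpow_smul_partialDeriv_bumpSum_le (h : IsSeparatedBalls D S x r C)
    (hD : IsOpen D) (hSD : Disjoint S D) (hA : ∀ b, 0 ≤ A b) (hk₁ : 0 < k₁) (hk₂ : 0 < k₂)
    (hρ : ∀ b, ∀ y ∈ Metric.closedBall (x b) (r b), k₁ * r b ≤ ρ y ∧ ρ y ≤ k₂ * r b)
    (a : ℝ) (α : Fin d → ℕ) {k : ℕ} (hα : ∑ i, α i = k) :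
    ∃ M, 0 ≤ M ∧ ∀ b, ∀ y ∈ Metric.closedBall (x b) (r b),
      ‖ρ y ^ ((k : ℝ) - a) • (partialDeriv α (bumpSum x r A) y : ℂ)‖ₑ ≤
        ENNReal.ofReal (M * A b * r b ^ (-a)) := by
  obtain ⟨M, hM, hbump⟩ := exists_abs_partialDeriv_scaledBump_le d k
  refine ⟨(k₁ ^ ((k : ℝ) - a) + k₂ ^ ((k : ℝ) - a)) * M, by positivity, fun b y hy => ?_⟩
  have hrb := h.pos b
  have hAb := hA b
  obtain ⟨hρ₁, hρ₂⟩ := hρ b y hy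
  have hρ₀ : 0 ≤ ρ y := (mul_pos hk₁ hrb).le.trans hρ₁
  rw [h.partialDeriv_bumpSum_of_mem hD hSD A α hy, ← ofReal_norm, norm_smul, Complex.norm_real,
    norm_mul, Real.norm_of_nonneg hAb, Real.norm_of_nonneg (by positivity)]
  refine ENNReal.ofReal_le_ofReal ?_
  calc ρ y ^ ((k : ℝ) - a) * (A b * ‖partialDeriv α (scaledBump (x b) (r b)) y‖)
      ≤ (k₁ ^ ((k : ℝ) - a) + k₂ ^ ((k : ℝ) - a)) * r b ^ ((k : ℝ) - a) *
          (A b * (M * (r b ^ k)⁻¹)) := by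
        gcongr
        · exact rpow_le_of_comparable hk₁ hrb hρ₁ hρ₂ _
        · exact hbump (x b) (r b) hrb α hα y
    _ = (k₁ ^ ((k : ℝ) - a) + k₂ ^ ((k : ℝ) - a)) * M * A b * r b ^ (-a) := by
        rw [sub_eq_add_neg, Real.rpow_add hrb, Real.rpow_natCast]
        field_simp

theorem memKondratiev_bumpSum [Countable ι] (h : IsSeparatedBalls D S x r C) (hD : IsOpen D)
    (hSD : Disjoint S D) (hA : ∀ b, 0 ≤ A b) (hk₁ : 0 < k₁) (hk₂ : 0 < k₂)
    (hρ : ∀ b, ∀ y ∈ Metric.closedBall (x b) (r b), k₁ * r b ≤ ρ y ∧ ρ y ≤ k₂ * r b)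
    {a p : ℝ} (hp : 0 < p) (hsum : ∑' b, ENNReal.ofReal (A b ^ p * r b ^ (d + -a * p)) < ⊤)
    (m : ℕ) : MemKondratiev D ρ m a p fun y => (bumpSum x r A y : ℂ) := by
  refine (iInf₂_le (fun α y => (partialDeriv α (bumpSum x r A) y : ℂ)) fun α _ =>
    hasWeakDeriv_partialDeriv hD (h.contDiffOn_bumpSum hD hSD A) α).trans_lt ?_
  refine ENNReal.rpow_lt_top_of_nonneg (by positivity) (ne_of_lt ?_)
  refine ENNReal.sum_lt_top.2 fun k _ => ENNReal.sum_lt_top.2 fun α hα => ?_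
  obtain ⟨M, hM, hbound⟩ := h.exists_enorm_rpow_smul_partialDeriv_bumpSum_le hD hSD hA hk₁ hk₂ hρ
    a α (Finset.mem_piAntidiag.1 hα).1
  refine h.lintegral_lt_top hA hM hp hsum hbound (fun y hyD hy => ?_) hD.measurableSet
  simp only [h.partialDeriv_bumpSum_of_forall_notMem hD hSD A α hyD hy, Complex.ofReal_zero,
    smul_zero, enorm_zero]

theorem eLpNorm_bumpSum_eq_top [Countable ι] (h : IsSeparatedBalls D S x r C) (hA : ∀ b, 0 ≤ A b)
    (hk₁ : 0 < k₁) (hk₂ : 0 < k₂)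
    (hρ : ∀ b, ∀ y ∈ Metric.closedBall (x b) (r b), k₁ * r b ≤ ρ y ∧ ρ y ≤ k₂ * r b)
    {e τ : ℝ} (hτ : 0 < τ) (hsum : ∑' b, ENNReal.ofReal (A b ^ τ * r b ^ (d + e * τ)) = ⊤) :
    eLpNorm (fun y => ρ y ^ e • (bumpSum x r A y : ℂ)) (ENNReal.ofReal τ)
      (volume.restrict D) = ⊤ := by
  rw [eLpNorm_eq_lintegral_rpow_enorm_toReal (ENNReal.ofReal_pos.2 hτ).ne' ENNReal.ofReal_ne_top,
    ENNReal.toReal_ofReal hτ.le, h.lintegral_eq_top hA (M := (k₁ ^ (-e) + k₂ ^ (-e))⁻¹)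
      (by positivity) hτ.le hsum fun b y hy => ENNReal.rpow_le_rpow ?_ hτ.le]
  · exact ENNReal.top_rpow_of_pos (by positivity)
  · have hrb := h.pos b
    obtain ⟨hρ₁, hρ₂⟩ := hρ b y (h.closedBall_half_subset b hy)
    have hρ₀ : 0 ≤ ρ y := (mul_pos hk₁ hrb).le.trans hρ₁
    rw [h.bumpSum_of_mem_half A hy, ← ofReal_norm, norm_smul, Complex.norm_real,
      Real.norm_of_nonneg (hA b), Real.norm_of_nonneg (by positivity), mul_right_comm]
    exact ENNReal.ofReal_le_ofReal
      (mul_le_mul_of_nonneg_right (le_rpow_of_comparable hk₁ hrb hρ₁ hρ₂ e) (hA b))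

end IsSeparatedBalls

theorem IsSmoothDistance.exists_comparable {d : ℕ} {D S : Set (Eucl d)} {ρ : Eucl d → ℝ}
    (hρ : IsSmoothDistance D S ρ) (hS : S.Nonempty) (hSD : Disjoint S D) {C : ℝ} (hC : 0 < C) :
    ∃ k₁ k₂ s : ℝ, 0 < k₁ ∧ 0 < k₂ ∧ 0 < s ∧ ∀ {ι : Type*} {x : ι → Eucl d} {r : ι → ℝ},
      IsSeparatedBalls D S x r C → (∀ b, r b ≤ s) →
      ∀ b, ∀ y ∈ Metric.closedBall (x b) (r b), k₁ * r b ≤ ρ y ∧ ρ y ≤ k₂ * r b := by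
  obtain ⟨ε, c', C', hε, hc', hC', heq⟩ := hρ.equiv
  refine ⟨c', C' * (C + 1), ε / (C + 2), hc', by positivity, by positivity, ?_⟩
  intro ι x r h hr b y hy
  have hle := h.infDist_le hy
  have hlt : Metric.infDist y S < ε := by
    have := (le_div_iff₀ (by positivity)).1 (hr b)
    linarith [h.pos b]
  obtain ⟨hρ₁, hρ₂⟩ := heq y (h.closedBall_subset b hy) hlt
  constructor
  · exact (mul_le_mul_of_nonneg_left (h.le_infDist hS hSD hy) hc'.le).trans hρ₁
  · rw [mul_assoc]
    exact hρ₂.trans (mul_le_mul_of_nonneg_left hle hC'.le)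

/-! ### Whitney cubes -/

theorem card_le_of_pairwiseDisjoint_closedBall {E ι : Type*} [NormedAddCommGroup E]
    [NormedSpace ℝ E] [FiniteDimensional ℝ E] {F : Finset ι} {c : ι → E} {s R : ℝ} {y : E}
    (hs : 0 < s) (hR : 0 ≤ R)
    (hdisj : (F : Set ι).PairwiseDisjoint fun i => Metric.closedBall (c i) s)
    (hF : ∀ i ∈ F, s + dist (c i) y ≤ R) : (F.card : ℝ) ≤ (R / s) ^ Module.finrank ℝ E := by
  borelize E
  let μ : Measure E := Measure.addHaar
  have hvol : ∑ i ∈ F, μ (Metric.closedBall (c i) s) ≤ μ (Metric.closedBall y R) := by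
    rw [← measure_biUnion_finset hdisj fun _ _ => Metric.isClosed_closedBall.measurableSet]
    exact measure_mono (iUnion₂_subset fun i hi => Metric.closedBall_subset_closedBall' (hF i hi))
  simp only [μ.addHaar_closedBall' _ hs.le, μ.addHaar_closedBall' _ hR, Finset.sum_const,
    nsmul_eq_mul, ← mul_assoc] at hvol
  rw [ENNReal.mul_le_mul_iff_left (Metric.measure_closedBall_pos _ _ one_pos).ne'
    measure_closedBall_lt_top.ne, ← ENNReal.ofReal_natCast, ← ENNReal.ofReal_mul (by positivity),
    ENNReal.ofReal_le_ofReal_iff (by positivity)] at hvol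
  rwa [div_pow, le_div_iff₀ (pow_pos hs _)]

theorem exists_le_of_hasSum_one {ι : Type*} {f : ι → ℝ} (hf : HasSum f 1) {N : ℝ}
    (hN : ∀ F : Finset ι, (∀ i ∈ F, f i ≠ 0) → (F.card : ℝ) ≤ N) :
    ∃ i, 1 / (2 * (N + 1)) ≤ f i := by
  classical
  have hN0 : 0 ≤ N := by simpa using hN ∅ (by simp)
  by_contra! hlt
  obtain ⟨F, hF⟩ := (hf.eventually (lt_mem_nhds (by norm_num : (1 / 2 : ℝ) < 1))).exists
  refine hF.not_ge ?_
  calc ∑ i ∈ F, f i = ∑ i ∈ F.filter (fun i => f i ≠ 0), f i :=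
        (Finset.sum_filter_ne_zero F).symm
    _ ≤ (F.filter fun i => f i ≠ 0).card * (1 / (2 * (N + 1))) := by
        rw [← nsmul_eq_mul]
        exact Finset.sum_le_card_nsmul _ _ _ fun i _ => (hlt i).le
    _ ≤ N * (1 / (2 * (N + 1))) := by
        gcongr
        exact hN _ fun i hi => (Finset.mem_filter.1 hi).2
    _ ≤ 1 / 2 := by
        rw [mul_one_div, div_le_div_iff₀ (by positivity) (by norm_num)]
        linarith

/-- The side length `2^{-j}` of the dyadic cube `Q_{j,k}`. -/
def sideLength {d : ℕ} (i : ℕ × (Fin d → ℤ)) : ℝ := ((2 : ℝ) ^ i.1)⁻¹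

/-- The centre of the cube `Q_{j,k}`. -/
def cubeCenter {d : ℕ} (i : ℕ × (Fin d → ℤ)) : Eucl d :=
  WithLp.toLp 2 fun n => sideLength i * (i.2 n + 1 / 2)

section Cubes

variable {d : ℕ} (i : ℕ × (Fin d → ℤ))

theorem sideLength_pos : 0 < sideLength i := by
  unfold sideLength
  positivity

theorem sideLength_le_one : sideLength i ≤ 1 :=
  inv_le_one_of_one_le₀ (one_le_pow₀ one_le_two)

theorem cubeCenter_mem_doubleCube : cubeCenter i ∈ doubleCube i := by
  intro n
  simp [cubeCenter, sideLength]

theorem ball_cubeCenter_subset_dyadicCube :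
    Metric.ball (cubeCenter i) (sideLength i / 2) ⊆ dyadicCube i := by
  intro y hy n
  have hyn : |y n - sideLength i * (i.2 n + 1 / 2)| < sideLength i / 2 :=
    (PiLp.norm_apply_le (y - cubeCenter i) n).trans_lt (mem_ball_iff_norm.1 hy)
  rw [abs_lt] at hyn
  change sideLength i * _ < _ ∧ _ < sideLength i * _
  constructor <;> linarith [hyn.1, hyn.2]

variable {i}

theorem dist_le_of_mem_doubleCube {y z : Eucl d} (hy : y ∈ doubleCube i) (hz : z ∈ doubleCube i) :
    dist y z ≤ 2 * d * sideLength i := by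
  have hcoord (n : Fin d) : ‖(y - z) n‖ ≤ 2 * sideLength i := by
    have hyn := abs_lt.1 (hy n)
    have hzn := abs_lt.1 (hz n)
    change |y n - z n| ≤ 2 * ((2 : ℝ) ^ i.1)⁻¹
    rw [abs_le]
    constructor <;> linarith
  calc dist y z = ‖∑ n, EuclideanSpace.single n ((y - z) n)‖ := by
        rw [dist_eq_norm]
        congr 1
        ext n
        simp [Finset.sum_apply, Pi.single_apply]
    _ ≤ ∑ n : Fin d, 2 * sideLength i :=
        (norm_sum_le _ _).trans (Finset.sum_le_sum fun n _ => by simpa using hcoord n)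
    _ = 2 * d * sideLength i := by simp; ring

end Cubes

namespace IsWhitneyDecomposition

variable {d : ℕ} {D : Set (Eucl d)} {W : Set (ℕ × (Fin d → ℤ))}

theorem exists_sideLength_comparable (hW : IsWhitneyDecomposition D W) :
    ∃ G : ℝ, 0 < G ∧ ∀ i ∈ W, ∀ y ∈ doubleCube i,
      sideLength i ≤ G * min 1 (Metric.infDist y (frontier D)) ∧
      min 1 (Metric.infDist y (frontier D)) ≤ G * sideLength i := by
  obtain ⟨c, hc, hlow⟩ := hW.lower
  obtain ⟨C, hC, hup⟩ := hW.upper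
  refine ⟨1 + c⁻¹ + (C + 2 * d), by positivity, fun i hi y hy => ?_⟩
  have hside := sideLength_pos i
  constructor
  · have h₁ : sideLength i ≤ c⁻¹ * Metric.infDist y (frontier D) := by
      rw [← div_eq_inv_mul, le_div_iff₀' hc]
      exact hlow i hi y hy
    have hinf : 0 < Metric.infDist y (frontier D) :=
      pos_of_mul_pos_right (hside.trans_le h₁) (by positivity)
    rcases min_cases 1 (Metric.infDist y (frontier D)) with ⟨h, -⟩ | ⟨h, -⟩ <;> rw [h]
    · nlinarith [sideLength_le_one i, inv_pos.2 hc]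
    · refine h₁.trans ?_
      gcongr
      linarith
  · rcases Nat.eq_zero_or_pos i.1 with h₀ | hpos
    · have hone : sideLength i = 1 := by simp [sideLength, h₀]
      rw [hone]
      exact (min_le_left _ _).trans (by linarith [inv_pos.2 hc])
    · obtain ⟨z, hz, hzC⟩ := hup i hi hpos
      have h₁ : Metric.infDist y (frontier D) ≤ (C + 2 * d) * sideLength i := by
        rw [add_mul]
        exact Metric.infDist_le_infDist_add_dist.trans
          (add_le_add hzC (dist_le_of_mem_doubleCube hy hz))
      refine (min_le_right _ _).trans (h₁.trans (mul_le_mul_of_nonneg_right ?_ hside.le))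
      linarith [inv_pos.2 hc]

theorem exists_card_le (hW : IsWhitneyDecomposition D W) :
    ∃ N : ℝ, 0 ≤ N ∧ ∀ (y : Eucl d) (F : Finset (ℕ × (Fin d → ℤ))),
      (∀ i ∈ F, i ∈ W ∧ y ∈ doubleCube i) → (F.card : ℝ) ≤ N := by
  obtain ⟨G, hG, hcomp⟩ := hW.exists_sideLength_comparable
  refine ⟨max 0 (((1 / (4 * G) + 2 * d * G) / (1 / (4 * G))) ^ d), le_max_left _ _,
    fun y F hF => ?_⟩
  rcases F.eq_empty_or_nonempty with rfl | ⟨i₀, hi₀⟩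
  · simp
  set t := min 1 (Metric.infDist y (frontier D))
  have ht : 0 < t := pos_of_mul_pos_right
    ((sideLength_pos i₀).trans_le (hcomp i₀ (hF i₀ hi₀).1 y (hF i₀ hi₀).2).1) hG.le
  have hsub (i) (hi : i ∈ F) :
      Metric.closedBall (cubeCenter i) (1 / (4 * G) * t) ⊆ dyadicCube i := by
    refine (Metric.closedBall_subset_ball ?_).trans (ball_cubeCenter_subset_dyadicCube i)
    have := (hcomp i (hF i hi).1 y (hF i hi).2).2
    rw [one_div_mul_eq_div, div_lt_iff₀ (by positivity)]
    nlinarith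
  have hcard := card_le_of_pairwiseDisjoint_closedBall (F := F) (c := cubeCenter) (y := y)
    (s := 1 / (4 * G) * t) (R := (1 / (4 * G) + 2 * d * G) * t) (by positivity) (by positivity)
    (fun i hi i' hi' hne => (hW.pairwiseDisjoint (hF i hi).1 (hF i' hi').1 hne).mono
      (hsub i hi) (hsub i' hi')) fun i hi => ?_
  · rw [mul_div_mul_right _ _ ht.ne', finrank_euclideanSpace_fin] at hcard
    exact hcard.trans (le_max_right _ _)
  · rw [add_mul, mul_assoc (2 * (d : ℝ))]
    refine add_le_add_right ((dist_le_of_mem_doubleCube (cubeCenter_mem_doubleCube i)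
      (hF i hi).2).trans ?_) _
    gcongr
    exact (hcomp i (hF i hi).1 y (hF i hi).2).1

end IsWhitneyDecomposition

theorem IsResolutionOfUnity.exists_forall_exists_le {d : ℕ} {D : Set (Eucl d)}
    {W : Set (ℕ × (Fin d → ℤ))} {ψ : ℕ × (Fin d → ℤ) → Eucl d → ℝ}
    (hψ : IsResolutionOfUnity D W ψ) (hW : IsWhitneyDecomposition D W) :
    ∃ ν : ℝ, 0 < ν ∧ ∀ y ∈ D, ∃ i ∈ W, ν ≤ ψ i y := by
  obtain ⟨N, hN, hcard⟩ := hW.exists_card_le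
  refine ⟨1 / (2 * (N + 1)), by positivity, fun y hy => ?_⟩
  obtain ⟨i, hi⟩ := exists_le_of_hasSum_one (hψ.hasSum_one y hy) fun F hF => by
    rw [← F.card_map (Function.Embedding.subtype _)]
    refine hcard y _ fun j hj => ?_
    obtain ⟨i, hi, rfl⟩ := Finset.mem_map.1 hj
    exact ⟨i.2, hψ.tsupport_subset i i.2 (subset_tsupport _ (hF i hi))⟩
  exact ⟨i, i.2, hi⟩

/-- Every ball is small, by the factor `η`, but not smaller than by the factor `G`, compared to each
cube of `W` whose double it meets, and the double of a cube meets at most one ball. -/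
structure IsAdaptedToCubes {d : ℕ} {ι : Type*} (W : Set (ℕ × (Fin d → ℤ))) (x : ι → Eucl d)
    (r : ι → ℝ) (η G : ℝ) : Prop where
  le_mul_sideLength : ∀ i ∈ W, ∀ b, ∀ y ∈ doubleCube i, y ∈ Metric.closedBall (x b) (r b) →
    r b ≤ η * sideLength i
  sideLength_le : ∀ i ∈ W, ∀ b, ∀ y ∈ doubleCube i, y ∈ Metric.closedBall (x b) (r b) →
    sideLength i ≤ G * r b
  eq_of_meets : ∀ i ∈ W, ∀ b, ∀ y ∈ doubleCube i, y ∈ Metric.closedBall (x b) (r b) →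
    ∀ b', ∀ y' ∈ doubleCube i, y' ∈ Metric.closedBall (x b') (r b') → b = b'

namespace IsWhitneyDecomposition

variable {d : ℕ} {D S : Set (Eucl d)} {W : Set (ℕ × (Fin d → ℤ))}

theorem exists_sideLength_comparable_radius (hW : IsWhitneyDecomposition D W) (hD : IsOpen D)
    (hS : S.Nonempty) (hSf : S ⊆ frontier D) {C : ℝ} (hC : 0 < C) :
    ∃ G : ℝ, 0 < G ∧ ∀ {ι : Type*} {x : ι → Eucl d} {r : ι → ℝ},
      IsSeparatedBalls D S x r C → (∀ b, r b ≤ 1) →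
      ∀ i ∈ W, ∀ b, ∀ y ∈ doubleCube i, y ∈ Metric.closedBall (x b) (r b) →
      sideLength i ≤ G * r b ∧ r b ≤ G * sideLength i := by
  obtain ⟨G, hG, hcomp⟩ := hW.exists_sideLength_comparable
  refine ⟨G * (C + 1), by positivity, fun h hr i hi b y hy hb => ⟨?_, ?_⟩⟩
  · rw [mul_assoc]
    refine (hcomp i hi y hy).1.trans (mul_le_mul_of_nonneg_left ((min_le_right _ _).trans ?_) hG.le)
    exact (Metric.infDist_le_infDist_of_subset hSf hS).trans (h.infDist_le hb)
  · have hdisj : Disjoint (frontier D) D := hD.frontier_eq ▸ disjoint_sdiff_left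
    refine ((le_min (hr b) (h.le_infDist (hS.mono hSf) hdisj hb)).trans
      (hcomp i hi y hy).2).trans (mul_le_mul_of_nonneg_right ?_ (sideLength_pos i).le)
    exact le_mul_of_one_le_right hG.le (by linarith)

theorem exists_isAdaptedToCubes (hW : IsWhitneyDecomposition D W) (hD : IsOpen D)
    (hS : S.Nonempty) (hSf : S ⊆ frontier D) {C : ℝ} (hC : 0 < C) :
    ∃ B G : ℝ, 0 ≤ B ∧ 0 < G ∧ ∀ {ι : Type*} {x : ι → Eucl d} {r : ι → ℝ},
      IsSeparatedBalls D S x r C → (∀ b, r b ≤ 1) →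
      HasRelativeGap x r B →
      ∀ ε, 0 < ε → ε ≤ 1 → IsAdaptedToCubes W x (fun b => ε * r b) (ε * G) (G / ε) := by
  obtain ⟨G, hG, hcomp⟩ := hW.exists_sideLength_comparable_radius hD hS hSf hC
  refine ⟨2 * d * G, G, by positivity, hG, fun {ι x r} h hr hsep ε hε hε1 => ?_⟩
  have hsub (b : ι) : Metric.closedBall (x b) (ε * r b) ⊆ Metric.closedBall (x b) (r b) :=
    Metric.closedBall_subset_closedBall (mul_le_of_le_one_left (h.pos b).le hε1)
  refine ⟨fun i hi b y hy hb => ?_, fun i hi b y hy hb => ?_,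
    fun i hi b y hy hb b' y' hy' hb' => ?_⟩
  · rw [mul_assoc]
    exact mul_le_mul_of_nonneg_left (hcomp h hr i hi b y hy (hsub b hb)).2 hε.le
  · exact (hcomp h hr i hi b y hy (hsub b hb)).1.trans_eq (by field_simp)
  · by_contra hne
    refine (hsep b b' hne).not_ge ?_
    have hmin : sideLength i ≤ G * min (r b) (r b') := by
      rw [mul_min_of_nonneg _ _ hG.le]
      exact le_min (hcomp h hr i hi b y hy (hsub b hb)).1
        (hcomp h hr i hi b' y' hy' (hsub b' hb')).1
    calc dist (x b) (x b') ≤ dist (x b) y + dist y y' + dist y' (x b') := dist_triangle4 _ _ _ _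
      _ ≤ r b + 2 * d * (G * min (r b) (r b')) + r b' := by
          gcongr
          · exact Metric.mem_closedBall'.1 (hsub b hb)
          · exact (dist_le_of_mem_doubleCube hy hy').trans (by gcongr)
          · exact hsub b' hb'
      _ = r b + r b' + 2 * d * G * min (r b) (r b') := by ring

end IsWhitneyDecomposition

/-! ### Refined localization norms of sums of bumps -/

theorem le_littlewoodPaleyFun {d : ℕ} (φ₀ g : 𝓢(Eucl d, ℂ)) (hφ₀ : φ₀ 0 = 1) {s q : ℝ}
    (hs : 1 ≤ s) (hq : 0 < q) (j : ℕ) {y : Eucl d}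
    (hg : ((2 : ℝ) ^ j) ^ d * (∫ ξ, ‖φ₀ ξ‖) * ∫ v, ‖g v‖ ≤ ‖g y‖ / 2) :
    ENNReal.ofReal ((2 : ℝ) ^ ((j : ℝ) * s) * (‖g y‖ / 2)) ≤ littlewoodPaleyFun φ₀ s q g y := by
  have hdiff : ‖g y‖ / 2 ≤ ‖g y - lowFreq φ₀ j g y‖ := by
    linarith [norm_sub_norm_le (g y) (lowFreq φ₀ j g y), norm_lowFreq_le φ₀ g j y]
  have hinv : (2 : ℝ) ^ ((j : ℝ) * s) * (2 : ℝ) ^ (-((j : ℝ) * s)) = 1 := by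
    rw [← Real.rpow_add two_pos, add_neg_cancel, Real.rpow_zero]
  calc ENNReal.ofReal ((2 : ℝ) ^ ((j : ℝ) * s) * (‖g y‖ / 2))
      ≤ ENNReal.ofReal ((2 : ℝ) ^ ((j : ℝ) * s)) * ‖g y - lowFreq φ₀ j g y‖ₑ := by
        rw [ENNReal.ofReal_mul (by positivity), ← ofReal_norm]
        gcongr
    _ ≤ ENNReal.ofReal ((2 : ℝ) ^ ((j : ℝ) * s)) *
          (ENNReal.ofReal ((2 : ℝ) ^ (-((j : ℝ) * s))) * littlewoodPaleyFun φ₀ s q g y) := by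
        gcongr
        exact enorm_sub_lowFreq_le φ₀ g hφ₀ hs hq j y
    _ = littlewoodPaleyFun φ₀ s q g y := by
        rw [← mul_assoc, ← ENNReal.ofReal_mul (by positivity), hinv, ENNReal.ofReal_one, one_mul]

namespace IsResolutionOfUnity

variable {d : ℕ} {D : Set (Eucl d)} {W : Set (ℕ × (Fin d → ℤ))}
  {ψ : ℕ × (Fin d → ℤ) → Eucl d → ℝ} {i : ℕ × (Fin d → ℤ)}

theorem le_one (hψ : IsResolutionOfUnity D W ψ) (hi : i ∈ W) {y : Eucl d} (hy : y ∈ D) :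
    ψ i y ≤ 1 :=
  le_hasSum (hψ.hasSum_one y hy) ⟨i, hi⟩ fun j _ => hψ.nonneg j j.2 y

theorem mem_doubleCube (hψ : IsResolutionOfUnity D W ψ) (hi : i ∈ W) {y : Eucl d}
    (hy : ψ i y ≠ 0) : y ∈ doubleCube i :=
  hψ.tsupport_subset i hi (subset_tsupport _ hy)

theorem exists_schwartz_mul_scaledBump (hψ : IsResolutionOfUnity D W ψ) (hi : i ∈ W) (z : Eucl d)
    {t : ℝ} (ht : 0 < t) (A : ℝ) :
    ∃ g : 𝓢(Eucl d, ℂ), ∀ y, g y = ((ψ i y * (A * scaledBump z t y) : ℝ) : ℂ) := by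
  have hsm : ContDiff ℝ ∞ fun y => ((ψ i y * (A * scaledBump z t y) : ℝ) : ℂ) :=
    Complex.ofRealCLM.contDiff.comp
      ((hψ.contDiff i hi).mul (contDiff_const.mul (contDiff_scaledBump z t)))
  have hcs : HasCompactSupport fun y => ψ i y * (A * scaledBump z t y) :=
    (hasCompactSupport_scaledBump z ht).mul_left.mul_left
  exact ⟨(hcs.comp_left (g := fun t : ℝ => (t : ℂ)) (by simp)).toSchwartzMap hsm, fun y => rfl⟩

theorem integral_norm_mul_scaledBump_le (hψ : IsResolutionOfUnity D W ψ) (hi : i ∈ W) {z : Eucl d}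
    {t A : ℝ} (ht : 0 < t) (hA : 0 ≤ A) (hball : Metric.closedBall z t ⊆ D) :
    ∫ y, ‖((ψ i y * (A * scaledBump z t y) : ℝ) : ℂ)‖ ≤
      A * (t ^ d * volume.real (Metric.closedBall (0 : Eucl d) 1)) := by
  have hzero : ∀ y ∉ Metric.closedBall z t, scaledBump z t y = 0 := fun y hy =>
    image_eq_zero_of_notMem_tsupport fun h => hy (tsupport_scaledBump_subset z ht h)
  have hvol : volume.real (Metric.closedBall z t) =
      t ^ d * volume.real (Metric.closedBall (0 : Eucl d) 1) := by
    rw [measureReal_def, volume_closedBall_eucl z ht.le, ENNReal.toReal_mul,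
      ENNReal.toReal_ofReal (by positivity), measureReal_def]
  rw [← setIntegral_eq_integral_of_forall_compl_eq_zero (s := Metric.closedBall z t)
    fun y hy => by simp [hzero y hy], ← hvol]
  refine (Real.le_norm_self _).trans
    (norm_setIntegral_le_of_norm_le_const measure_closedBall_lt_top fun y hy => ?_)
  have hbump : 0 ≤ A * scaledBump z t y := mul_nonneg hA (scaledBump_nonneg _ _ _)
  rw [norm_norm, Complex.norm_real, Real.norm_of_nonneg (mul_nonneg (hψ.nonneg i hi y) hbump)]
  exact (mul_le_of_le_one_left hbump (hψ.le_one hi (hball hy))).trans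
    (mul_le_of_le_one_right hA (scaledBump_le_one _ _ _))

theorem pow_mul_integral_norm_mul_scaledBump_le (hψ : IsResolutionOfUnity D W ψ) (hi : i ∈ W)
    {z : Eucl d} {t A : ℝ} (ht : 0 < t) (hA : 0 ≤ A) (hball : Metric.closedBall z t ⊆ D)
    {M η I : ℝ} (hM : 0 ≤ M) (hη : M * t ≤ η) (hI : 0 ≤ I) :
    M ^ d * I * ∫ y, ‖((ψ i y * (A * scaledBump z t y) : ℝ) : ℂ)‖ ≤
      η ^ d * I * volume.real (Metric.closedBall (0 : Eucl d) 1) * A := by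
  calc M ^ d * I * ∫ y, ‖((ψ i y * (A * scaledBump z t y) : ℝ) : ℂ)‖
      ≤ M ^ d * I * (A * (t ^ d * volume.real (Metric.closedBall (0 : Eucl d) 1))) := by
        gcongr
        exact hψ.integral_norm_mul_scaledBump_le hi ht hA hball
    _ = (M * t) ^ d * I * volume.real (Metric.closedBall (0 : Eucl d) 1) * A := by ring
    _ ≤ η ^ d * I * volume.real (Metric.closedBall (0 : Eucl d) 1) * A := by gcongr

end IsResolutionOfUnity

theorem IsAdaptedToCubes.mul_rpow_neg_le {d : ℕ} {ι : Type*} {W : Set (ℕ × (Fin d → ℤ))}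
    {x : ι → Eucl d} {r : ι → ℝ} {η G : ℝ} (hAd : IsAdaptedToCubes W x r η G)
    {i : ℕ × (Fin d → ℤ)} (hi : i ∈ W) {b : ι} {y : Eucl d} (hy : y ∈ doubleCube i)
    (hyb : y ∈ Metric.closedBall (x b) (r b)) {s : ℝ} (hs : 0 ≤ s) :
    (G * r b) ^ (-s) ≤ (2 : ℝ) ^ ((i.1 : ℝ) * s) := by
  have hle := Real.rpow_le_rpow_of_nonpos (sideLength_pos i) (hAd.sideLength_le i hi b y hy hyb)
    (neg_nonpos.2 hs)
  rwa [sideLength, ← Real.rpow_natCast, ← Real.rpow_neg two_pos.le, ← Real.rpow_mul two_pos.le,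
    neg_mul_neg] at hle

namespace IsSeparatedBalls

variable {d : ℕ} {ι : Type*} {D S : Set (Eucl d)} {x : ι → Eucl d} {r : ι → ℝ} {C : ℝ}
  {W : Set (ℕ × (Fin d → ℤ))} {η G : ℝ} {ψ : ℕ × (Fin d → ℤ) → Eucl d → ℝ}
  {i : ℕ × (Fin d → ℤ)}

theorem smul_bumpSum_eq (h : IsSeparatedBalls D S x r C) (hAd : IsAdaptedToCubes W x r η G)
    (hψ : IsResolutionOfUnity D W ψ) (A : ι → ℝ) (hi : i ∈ W) {b : ι} {z : Eucl d}
    (hz : z ∈ doubleCube i) (hzb : z ∈ Metric.closedBall (x b) (r b)) (y : Eucl d) :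
    ψ i y • (bumpSum x r A y : ℂ) = ((ψ i y * (A b * scaledBump (x b) (r b) y) : ℝ) : ℂ) := by
  rw [Complex.real_smul, ← Complex.ofReal_mul]
  congr 1
  by_cases hy : ψ i y = 0
  · rw [hy, zero_mul, zero_mul]
  congr 1
  by_cases hyb : y ∈ Metric.closedBall (x b) (r b)
  · exact h.bumpSum_of_mem A hyb
  rw [h.scaledBump_eq_zero hyb, mul_zero]
  refine h.bumpSum_of_forall_notMem A fun b' hyb' => hyb ?_
  rwa [hAd.eq_of_meets i hi b z hz hzb b' y (hψ.mem_doubleCube hi hy) hyb']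

theorem exists_schwartz_smul_bumpSum_eq (h : IsSeparatedBalls D S x r C)
    (hAd : IsAdaptedToCubes W x r η G) (hψ : IsResolutionOfUnity D W ψ) (A : ι → ℝ) (hi : i ∈ W) :
    ∃ g : 𝓢(Eucl d, ℂ), (fun y => ψ i y • (bumpSum x r A y : ℂ)) = g := by
  by_cases hmeets : ∃ b, ∃ z ∈ doubleCube i, z ∈ Metric.closedBall (x b) (r b)
  · obtain ⟨b, z, hz, hzb⟩ := hmeets
    obtain ⟨g, hg⟩ := hψ.exists_schwartz_mul_scaledBump hi (x b) (h.pos b) (A b)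
    exact ⟨g, funext fun y => by rw [h.smul_bumpSum_eq hAd hψ A hi hz hzb, hg]⟩
  · push Not at hmeets
    refine ⟨0, funext fun y => ?_⟩
    by_cases hy : ψ i y = 0
    · simp [hy]
    · simp [h.bumpSum_of_forall_notMem A fun b => hmeets b y (hψ.mem_doubleCube hi hy)]

theorem le_littlewoodPaleyFun_smul_bumpSum (h : IsSeparatedBalls D S x r C)
    (hAd : IsAdaptedToCubes W x r η G) (hψ : IsResolutionOfUnity D W ψ) {φ₀ : 𝓢(Eucl d, ℂ)}
    (hφ₀ : φ₀ 0 = 1) {A : ι → ℝ} (hA : ∀ b, 0 ≤ A b) {s q : ℝ} (hs : 1 ≤ s) (hq : 0 < q)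
    {ν : ℝ} (hν : 0 < ν)
    (hη : η ^ d * (∫ ξ, ‖φ₀ ξ‖) * volume.real (Metric.closedBall (0 : Eucl d) 1) ≤ ν / 2)
    (hi : i ∈ W) {b : ι} {y : Eucl d} (hy : y ∈ Metric.closedBall (x b) (1 / 2 * r b))
    (hνy : ν ≤ ψ i y) :
    ENNReal.ofReal (ν / 2 * G ^ (-s) * A b * r b ^ (-s)) ≤
      littlewoodPaleyFun φ₀ s q (fun z => ψ i z • (bumpSum x r A z : ℂ)) y := by
  have hrb := h.pos b
  have hAb := hA b
  have hyb := h.closedBall_half_subset b hy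
  have hyi := hψ.mem_doubleCube hi (hν.trans_le hνy).ne'
  have hsmall : (2 : ℝ) ^ i.1 * r b ≤ η := by
    have := hAd.le_mul_sideLength i hi b y hyi hyb
    rwa [sideLength, ← div_eq_mul_inv, le_div_iff₀' (by positivity)] at this
  have hG : 0 < G :=
    pos_of_mul_pos_left ((sideLength_pos i).trans_le (hAd.sideLength_le i hi b y hyi hyb)) hrb.le
  obtain ⟨g, hg⟩ := hψ.exists_schwartz_mul_scaledBump hi (x b) hrb (A b)
  have hgeq : (fun z => ψ i z • (bumpSum x r A z : ℂ)) = g := funext fun z => by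
    rw [h.smul_bumpSum_eq hAd hψ A hi hyi hyb, hg]
  have hgy : ν * A b ≤ ‖g y‖ := by
    rw [hg, scaledBump_eq_one hrb hy, mul_one, Complex.norm_real,
      Real.norm_of_nonneg (mul_nonneg (hψ.nonneg i hi y) hAb)]
    exact mul_le_mul_of_nonneg_right hνy hAb
  have hint : ((2 : ℝ) ^ i.1) ^ d * (∫ ξ, ‖φ₀ ξ‖) * ∫ v, ‖g v‖ ≤ ‖g y‖ / 2 := by
    simp_rw [hg]
    refine (hψ.pow_mul_integral_norm_mul_scaledBump_le hi hrb hAb (h.closedBall_subset b)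
      (by positivity) hsmall (integral_nonneg fun _ => norm_nonneg _)).trans
      ((mul_le_mul_of_nonneg_right hη hAb).trans ?_)
    rw [← hg]
    linarith
  rw [hgeq]
  refine le_trans (ENNReal.ofReal_le_ofReal ?_) (le_littlewoodPaleyFun φ₀ g hφ₀ hs hq i.1 hint)
  calc ν / 2 * G ^ (-s) * A b * r b ^ (-s) = (G * r b) ^ (-s) * (ν * A b / 2) := by
        rw [Real.mul_rpow hG.le hrb.le]
        ring
    _ ≤ (2 : ℝ) ^ ((i.1 : ℝ) * s) * (‖g y‖ / 2) := by
        gcongr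
        exact hAd.mul_rpow_neg_le hi hyi hyb (zero_le_one.trans hs)

theorem rlocNorm_bumpSum_eq_top [Countable ι] (h : IsSeparatedBalls D S x r C)
    (hAd : IsAdaptedToCubes W x r η G) (hG : 0 < G) (hψ : IsResolutionOfUnity D W ψ)
    {φ₀ : 𝓢(Eucl d, ℂ)} (hφ₀ : φ₀ 0 = 1) {A : ι → ℝ} (hA : ∀ b, 0 ≤ A b) {s τ q : ℝ}
    (hs : 1 ≤ s) (hτ : 0 < τ) (hq : 0 < q) {ν : ℝ} (hν : 0 < ν)
    (hη : η ^ d * (∫ ξ, ‖φ₀ ξ‖) * volume.real (Metric.closedBall (0 : Eucl d) 1) ≤ ν / 2)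
    (hνψ : ∀ y ∈ D, ∃ i ∈ W, ν ≤ ψ i y)
    (hsum : ∑' b, ENNReal.ofReal (A b ^ τ * r b ^ (d + -s * τ)) = ⊤) :
    rlocNorm W ψ φ₀ s τ q (fun y => (bumpSum x r A y : ℂ)) = ⊤ := by
  have hmeas (i : W) : Measurable
      (littlewoodPaleyFun φ₀ s q fun z => ψ i z • (bumpSum x r A z : ℂ)) := by
    obtain ⟨g, hg⟩ := h.exists_schwartz_smul_bumpSum_eq hAd hψ A i.2
    rw [hg]
    exact measurable_littlewoodPaleyFun φ₀ g s q
  have htop := h.lintegral_eq_top hA (M := ν / 2 * G ^ (-s)) (by positivity) hτ.le hsum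
    (g := fun y => ∑' i : W,
      littlewoodPaleyFun φ₀ s q (fun z => ψ i z • (bumpSum x r A z : ℂ)) y ^ τ) fun b y hy => by
    obtain ⟨i, hi, hνy⟩ := hνψ y (h.closedBall_subset b (h.closedBall_half_subset b hy))
    exact (ENNReal.rpow_le_rpow (h.le_littlewoodPaleyFun_smul_bumpSum hAd hψ hφ₀ hA hs hq hν hη hi
      hy hνy) hτ.le).trans (ENNReal.le_tsum (⟨i, hi⟩ : W))
  rw [rlocNorm, ENNReal.rpow_eq_top_iff_of_pos (by positivity)]
  simp_rw [triebelLizorkinNorm_rpow φ₀ s q hτ.ne']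
  rw [← lintegral_tsum fun i => ((hmeas i).pow_const τ).aemeasurable]
  exact top_unique (htop.symm.trans_le (setLIntegral_le_lintegral D _))

end IsSeparatedBalls

theorem IsWhitneyDecomposition.exists_rlocNorm_bumpSum_eq_top {d : ℕ} (hd : d ≠ 0)
    {D S : Set (Eucl d)} (hD : IsOpen D) (hS : S.Nonempty) (hSf : S ⊆ frontier D)
    {W : Set (ℕ × (Fin d → ℤ))} (hW : IsWhitneyDecomposition D W)
    {ψ : ℕ × (Fin d → ℤ) → Eucl d → ℝ} (hψ : IsResolutionOfUnity D W ψ)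
    {φ₀ : 𝓢(Eucl d, ℂ)} (hφ₀ : φ₀ 0 = 1) {C : ℝ} (hC : 0 < C) :
    ∃ B ε : ℝ, 0 ≤ B ∧ 0 < ε ∧ ε ≤ 1 ∧ ∀ {ι : Type*} [Countable ι] {x : ι → Eucl d} {r : ι → ℝ},
      IsSeparatedBalls D S x r C → (∀ b, r b ≤ 1) →
      HasRelativeGap x r B →
      ∀ {A : ι → ℝ}, (∀ b, 0 ≤ A b) → ∀ {s τ q : ℝ}, 1 ≤ s → 0 < τ → 0 < q →
      ∑' b, ENNReal.ofReal (A b ^ τ * (ε * r b) ^ (d + -s * τ)) = ⊤ →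
      rlocNorm W ψ φ₀ s τ q (fun y => (bumpSum x (fun b => ε * r b) A y : ℂ)) = ⊤ := by
  obtain ⟨B, G, hB, hG, hAd⟩ := hW.exists_isAdaptedToCubes hD hS hSf hC
  obtain ⟨ν, hν, hνψ⟩ := hψ.exists_forall_exists_le hW
  set I := (∫ ξ, ‖φ₀ ξ‖) * volume.real (Metric.closedBall (0 : Eucl d) 1)
  have hI : 0 ≤ I := mul_nonneg (integral_nonneg fun _ => norm_nonneg _) measureReal_nonneg
  obtain ⟨ε, hε, hlt⟩ :=
    exists_pos_mul_lt (lt_min one_pos (half_pos hν)) (1 + G + G * I)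
  have hG₀ := mul_nonneg hG.le hε.le
  have hI₀ := mul_nonneg hG₀ hI
  have hε1 : ε ≤ 1 := by linarith [min_le_left 1 (ν / 2)]
  have hεG : ε * G ≤ 1 := by linarith [min_le_left 1 (ν / 2)]
  have hη : (ε * G) ^ d * (∫ ξ, ‖φ₀ ξ‖) * volume.real (Metric.closedBall (0 : Eucl d) 1) ≤
      ν / 2 := by
    calc _ = (ε * G) ^ d * I := mul_assoc _ _ _
      _ ≤ ε * G * I := by gcongr; exact pow_le_of_le_one (by positivity) hεG hd
      _ ≤ ν / 2 := by linarith [min_le_right 1 (ν / 2)]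
  refine ⟨B, ε, hB, hε, hε1, fun h hr hsep A hA s τ q hs hτ hq hsum => ?_⟩
  exact (h.shrink hε hε1).rlocNorm_bumpSum_eq_top (hAd h hr hsep ε hε hε1) (by positivity) hψ hφ₀
    hA hs hτ hq hν hη hνψ hsum

/-! ### Balls accumulating along an edge -/

/-- Indices of the balls along an edge of dimension `δ`: generation `n` consists of `(R ^ n) ^ δ`
balls, which are centred over a lattice of mesh size proportional to `R ^ (-n)`. -/
abbrev EdgeIndex (δ R : ℕ) : Type := Σ n : ℕ, (Fin δ → Fin (R ^ n))

/-- The radius of the balls of generation `n` along an edge. -/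
def edgeRadius {δ R : ℕ} (κ : ℝ) (b : EdgeIndex δ R) : ℝ := κ * ((R : ℝ) ^ b.1)⁻¹

section EdgeRadius

variable {δ R : ℕ} {κ : ℝ}

theorem edgeRadius_pos (hκ : 0 < κ) (hR : 2 ≤ R) (b : EdgeIndex δ R) : 0 < edgeRadius κ b := by
  unfold edgeRadius
  positivity

theorem edgeRadius_le (hκ : 0 < κ) (hR : 2 ≤ R) (b : EdgeIndex δ R) : edgeRadius κ b ≤ κ :=
  mul_le_of_le_one_right hκ.le
    (inv_le_one_of_one_le₀ (one_le_pow₀ (by exact_mod_cast one_le_two.trans hR)))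

theorem mul_edgeRadius_le (hκ : 0 < κ) (hR : 2 ≤ R) {b b' : EdgeIndex δ R} (h : b.1 < b'.1) :
    R * edgeRadius κ b' ≤ edgeRadius κ b := by
  have hR1 : (1 : ℝ) ≤ R := by exact_mod_cast one_le_two.trans hR
  calc R * (κ * ((R : ℝ) ^ b'.1)⁻¹) ≤ R * (κ * ((R : ℝ) ^ (b.1 + 1))⁻¹) := by
        gcongr
        exact h
    _ = κ * ((R : ℝ) ^ b.1)⁻¹ := by
        field_simp
        ring

theorem finite_le_edgeRadius (hR : 2 ≤ R) {t : ℝ} (ht : 0 < t) :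
    {b : EdgeIndex δ R | t ≤ edgeRadius κ b}.Finite := by
  have hR1 : (1 : ℝ) < R := by exact_mod_cast hR
  obtain ⟨N, hN⟩ := pow_unbounded_of_one_lt (κ / t) hR1
  refine ((Finset.range N).sigma fun n =>
    (Finset.univ : Finset (Fin δ → Fin (R ^ n)))).finite_toSet.subset fun b hb => ?_
  simp only [Finset.coe_sigma, Finset.coe_range, Finset.coe_univ, mem_sigma_iff, mem_Iio, mem_univ,
    and_true]
  have hb' : (R : ℝ) ^ b.1 ≤ κ / t := by
    rw [le_div_iff₀ ht, ← le_div_iff₀' (by positivity)]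
    exact hb
  exact (pow_lt_pow_iff_right₀ hR1).1 (hb'.trans_lt hN)

end EdgeRadius

theorem exists_separated_lattice {E : Type*} [NormedAddCommGroup E] [InnerProductSpace ℝ E]
    [FiniteDimensional ℝ E] (δ : ℕ) (hE : Module.finrank ℝ E = δ) {R : ℕ} (hR : R ≠ 0) :
    ∃ w : EdgeIndex δ R → E, (∀ b, ‖w b‖ ≤ δ) ∧
      ∀ n k k', k ≠ k' → ((R : ℝ) ^ n)⁻¹ ≤ ‖w ⟨n, k⟩ - w ⟨n, k'⟩‖ := by
  let e := (stdOrthonormalBasis ℝ E).reindex (finCongr hE)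
  let v (b : EdgeIndex δ R) : EuclideanSpace ℝ (Fin δ) := WithLp.toLp 2 fun i => ((b.2 i : ℕ) : ℝ)
  refine ⟨fun b => ((R : ℝ) ^ b.1)⁻¹ • e.repr.symm (v b), fun b => ?_, fun n k k' hk => ?_⟩
  · have hRn : (0 : ℝ) < (R : ℝ) ^ b.1 := by positivity
    rw [norm_smul, Real.norm_of_nonneg (by positivity), inv_mul_le_iff₀ hRn, ← e.sum_repr_symm]
    calc ‖∑ i, v b i • e i‖ ≤ ∑ _ : Fin δ, (R : ℝ) ^ b.1 := by
          refine (norm_sum_le _ _).trans (Finset.sum_le_sum fun i _ => ?_)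
          rw [norm_smul, e.norm_eq_one, mul_one]
          simpa [v] using mod_cast (b.2 i).2.le
      _ = (R : ℝ) ^ b.1 * δ := by simp [mul_comm]
  · obtain ⟨i, hi⟩ := Function.ne_iff.1 hk
    have hone : (1 : ℤ) ≤ |((k i : ℕ) : ℤ) - (k' i : ℕ)| :=
      Int.one_le_abs (sub_ne_zero.2 fun h => hi (Fin.ext (by exact_mod_cast h)))
    rw [← smul_sub, ← map_sub, norm_smul, LinearIsometryEquiv.norm_map,
      Real.norm_of_nonneg (by positivity)]
    refine le_mul_of_one_le_right (by positivity) (le_trans ?_ (PiLp.norm_apply_le _ i))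
    have : (1 : ℝ) ≤ |((k i : ℕ) : ℝ) - (k' i : ℕ)| := by exact_mod_cast hone
    simpa [v] using this

/-- The model domain `K` near a point of the edge `V`: an open cone with vertex `0 ∉ K` which is
invariant under translations along `V`. -/
structure IsEdgeCone {E : Type*} [NormedAddCommGroup E] [NormedSpace ℝ E] (V : Submodule ℝ E)
    (K : Set E) : Prop where
  isOpen : IsOpen K
  nonempty : K.Nonempty
  smul_mem : ∀ t : ℝ, 0 < t → ∀ y ∈ K, t • y ∈ K
  add_mem : ∀ v ∈ V, ∀ y ∈ K, y + v ∈ K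
  zero_notMem : 0 ∉ K

namespace IsEdgeCone

section Normed

variable {E : Type*} [NormedAddCommGroup E] [NormedSpace ℝ E] {V : Submodule ℝ E} {K : Set E}
  {δ R : ℕ}

theorem smul_add_mem (hK : IsEdgeCone V K) {t : ℝ} (ht : 0 < t) {y w : E} (hy : y ∈ K)
    (hw : w ∈ V) : t • y + w ∈ K :=
  hK.add_mem w hw _ (hK.smul_mem t ht y hy)

theorem exists_ball_subset (hK : IsEdgeCone V K) {M : ℝ} (hM : 0 < M) :
    ∃ y, Metric.ball y M ⊆ K := by
  obtain ⟨y, hy⟩ := hK.nonempty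
  obtain ⟨ε, hε, hball⟩ := Metric.isOpen_iff.1 hK.isOpen y hy
  refine ⟨(M / ε) • y, fun z hz => ?_⟩
  have hpos : 0 < M / ε := by positivity
  have hmem := hK.smul_mem _ hpos ((M / ε)⁻¹ • z) (hball ?_)
  · rwa [smul_inv_smul₀ hpos.ne'] at hmem
  · rw [mem_ball_iff_norm] at hz ⊢
    rw [← inv_smul_smul₀ hpos.ne' y, ← smul_sub, norm_smul, norm_inv, Real.norm_of_nonneg hpos.le,
      inv_mul_lt_iff₀ hpos, div_mul_cancel₀ _ hε.ne']
    exact hz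

theorem ball_smul_add_subset (hK : IsEdgeCone V K) {y : E} {M : ℝ} (hball : Metric.ball y M ⊆ K)
    {t : ℝ} (ht : 0 < t) {w : E} (hw : w ∈ V) : Metric.ball (t • y + w) (t * M) ⊆ K := by
  intro z hz
  have hmem := hK.smul_add_mem ht (y := y + t⁻¹ • (z - (t • y + w))) (hball ?_) hw
  · rw [smul_add, smul_inv_smul₀ ht.ne'] at hmem
    convert hmem using 1
    abel
  · rwa [mem_ball_iff_norm, add_sub_cancel_left, norm_smul, norm_inv, Real.norm_of_nonneg ht.le,
      inv_mul_lt_iff₀ ht, ← mem_ball_iff_norm]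

theorem mul_le_norm_smul_add (hK : IsEdgeCone V K) {y : E} {M : ℝ} (hball : Metric.ball y M ⊆ K)
    {t : ℝ} (ht : 0 < t) {w : E} (hw : w ∈ V) : t * M ≤ ‖t • y + w‖ := by
  by_contra! hlt
  exact hK.zero_notMem (hK.ball_smul_add_subset hball ht hw (by simpa using hlt))

theorem dist_smul_add_gt (hK : IsEdgeCone V K) {y : E} (hball : Metric.ball y 2 ⊆ K)
    {B t t' : ℝ} (ht' : 0 < t') (htt' : (3 + B) * t' < t) (hB : 0 ≤ B) {w w' : E} (hw : w ∈ V)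
    (hw' : w' ∈ V) : t + t' + B * min t t' < dist (t • y + w) (t' • y + w') := by
  have hlt : t' < t := by nlinarith
  calc t + t' + B * min t t' ≤ t + t' + B * t' := by
        gcongr
        exact min_le_right _ _
    _ < (t - t') * 2 := by linarith
    _ ≤ ‖(t - t') • y + (w - w')‖ :=
        hK.mul_le_norm_smul_add hball (sub_pos.2 hlt) (V.sub_mem hw hw')
    _ = dist (t • y + w) (t' • y + w') := by
        rw [dist_eq_norm, sub_smul]
        congr 1
        abel

theorem edge_dist_gt (hK : IsEdgeCone V K) {y : E} (hball : Metric.ball y 2 ⊆ K) (hR : 2 ≤ R)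
    {B κ σ : ℝ} (hB : 0 ≤ B) (hBR : 3 + B < R) (hκ : 0 < κ) (hσ : (2 + B) * κ < σ)
    {w : EdgeIndex δ R → V}
    (hw : ∀ n k k', k ≠ k' → ((R : ℝ) ^ n)⁻¹ ≤ ‖w ⟨n, k⟩ - w ⟨n, k'⟩‖) {b b' : EdgeIndex δ R}
    (hne : b ≠ b') :
    edgeRadius κ b + edgeRadius κ b' + B * min (edgeRadius κ b) (edgeRadius κ b') <
      dist (edgeRadius κ b • y + σ • (w b : E)) (edgeRadius κ b' • y + σ • (w b' : E)) := by
  have hσw (b : EdgeIndex δ R) : σ • (w b : E) ∈ V := V.smul_mem σ (w b).2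
  have hgen {b b' : EdgeIndex δ R} (hlt : b.1 < b'.1) :
      (3 + B) * edgeRadius κ b' < edgeRadius κ b :=
    (mul_lt_mul_of_pos_right hBR (edgeRadius_pos hκ hR b')).trans_le (mul_edgeRadius_le hκ hR hlt)
  rcases lt_trichotomy b.1 b'.1 with hlt | heq | hgt
  · exact hK.dist_smul_add_gt hball (edgeRadius_pos hκ hR b') (hgen hlt) hB (hσw b) (hσw b')
  · obtain ⟨n, k⟩ := b
    obtain ⟨n', k'⟩ := b'
    obtain rfl : n = n' := heq
    have hσ0 : 0 < σ := lt_trans (by positivity) hσ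
    calc edgeRadius κ ⟨n, k⟩ + edgeRadius κ ⟨n, k'⟩ +
          B * min (edgeRadius κ ⟨n, k⟩) (edgeRadius κ ⟨n, k'⟩)
        = (2 + B) * κ * ((R : ℝ) ^ n)⁻¹ := by
          simp only [edgeRadius, min_self]
          ring
      _ < σ * ((R : ℝ) ^ n)⁻¹ := by gcongr
      _ ≤ σ * ‖w ⟨n, k⟩ - w ⟨n, k'⟩‖ := by
          gcongr
          exact hw n k k' fun h => hne (by rw [h])
      _ = dist (edgeRadius κ ⟨n, k⟩ • y + σ • (w ⟨n, k⟩ : E))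
            (edgeRadius κ ⟨n, k'⟩ • y + σ • (w ⟨n, k'⟩ : E)) := by
          simp only [edgeRadius, dist_add_left, dist_smul₀, Real.norm_of_nonneg hσ0.le]
          rw [← dist_eq_norm, Subtype.dist_eq]
  · rw [dist_comm, add_comm (edgeRadius κ b), min_comm]
    exact hK.dist_smul_add_gt hball (edgeRadius_pos hκ hR b) (hgen hgt) hB (hσw b') (hσw b)

end Normed

variable {E : Type*} [NormedAddCommGroup E] [InnerProductSpace ℝ E] [FiniteDimensional ℝ E]
  {V : Submodule ℝ E} {K : Set E} {δ : ℕ}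

theorem exists_isSeparatedBalls (hK : IsEdgeCone V K) (hV : Module.finrank ℝ V = δ) :
    ∃ C : ℝ, 0 < C ∧ ∀ B t : ℝ, 0 ≤ B → 0 < t → ∃ (κ : ℝ) (R : ℕ), 0 < κ ∧ κ ≤ t ∧ 2 ≤ R ∧
      ∃ z : EdgeIndex δ R → E, IsSeparatedBalls K V z (edgeRadius κ) C ∧ (∀ b, ‖z b‖ ≤ t) ∧
        HasRelativeGap z (edgeRadius κ) B := by
  obtain ⟨y, hball⟩ := hK.exists_ball_subset two_pos
  have hy : 0 < ‖y‖ := norm_pos_iff.2 fun h =>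
    hK.zero_notMem (hball (h ▸ Metric.mem_ball_self two_pos))
  refine ⟨‖y‖, hy, fun B t hB ht => ?_⟩
  obtain ⟨σ, hσ, hσt⟩ := exists_pos_mul_lt (half_pos ht) (δ : ℝ)
  obtain ⟨κ, hκ, hκlt⟩ := exists_pos_mul_lt (lt_min (half_pos ht) hσ) (1 + ‖y‖ + (2 + B))
  obtain ⟨hκt, hκσ⟩ : (1 + ‖y‖ + (2 + B)) * κ < t / 2 ∧ (1 + ‖y‖ + (2 + B)) * κ < σ :=
    lt_min_iff.1 hκlt
  have hκy : 0 < ‖y‖ * κ := mul_pos hy hκ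
  have hκB : 0 < (2 + B) * κ := by positivity
  obtain ⟨R, hBR⟩ := exists_nat_gt (3 + B)
  have hR : 2 ≤ R := by exact_mod_cast (by linarith : (2 : ℝ) ≤ R)
  obtain ⟨w, hwδ, hw⟩ := exists_separated_lattice δ hV (R := R) (by omega)
  have hrpos (b : EdgeIndex δ R) := edgeRadius_pos hκ hR b
  have hsep {b b' : EdgeIndex δ R} (hne : b ≠ b') :=
    hK.edge_dist_gt hball hR hB hBR hκ (σ := σ) (by linarith) hw hne
  refine ⟨κ, R, hκ, by linarith, hR, fun b => edgeRadius κ b • y + σ • (w b : E),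
    ⟨hrpos, fun b => ?_, fun b => ⟨σ • (w b : E), V.smul_mem σ (w b).2, ?_⟩, fun b b' hne => ?_,
      fun s hs => finite_le_edgeRadius hR hs⟩, fun b => ?_, fun b b' hne => hsep hne⟩
  · rw [mul_comm]
    exact hK.ball_smul_add_subset hball (hrpos b) (V.smul_mem σ (w b).2)
  · rw [dist_eq_norm, add_sub_cancel_right, norm_smul, Real.norm_of_nonneg (hrpos b).le, mul_comm]
  · exact (le_add_of_nonneg_right (mul_nonneg hB (lt_min (hrpos b) (hrpos b')).le)).trans_lt
      (hsep hne)
  · calc ‖edgeRadius κ b • y + σ • (w b : E)‖ ≤ edgeRadius κ b * ‖y‖ + σ * ‖w b‖ := by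
          refine (norm_add_le _ _).trans_eq ?_
          rw [norm_smul, norm_smul, Real.norm_of_nonneg (hrpos b).le, Real.norm_of_nonneg hσ.le,
            V.coe_norm]
      _ ≤ κ * ‖y‖ + σ * δ := by
          gcongr
          · exact edgeRadius_le hκ hR b
          · exact hwδ b
      _ ≤ t := by linarith

end IsEdgeCone

theorem exists_lipschitzOnWith_chart {E F : Type*} [NormedAddCommGroup E]
    [NormedSpace ℝ E] [NormedAddCommGroup F] [NormedSpace ℝ F] (Φ : OpenPartialHomeomorph E F)
    {x : E} (hx : x ∈ Φ.source) (hΦ : ContDiffAt ℝ 1 Φ x) (hΦs : ContDiffAt ℝ 1 Φ.symm (Φ x)) :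
    ∃ (L : ℝ≥0) (s t : ℝ), 0 < L ∧ 0 < s ∧ 0 < t ∧ Metric.ball x s ⊆ Φ.source ∧
      Metric.ball (Φ x) t ⊆ Φ.target ∧ LipschitzOnWith L Φ (Metric.ball x s) ∧
      LipschitzOnWith L Φ.symm (Metric.ball (Φ x) t) ∧
      MapsTo Φ.symm (Metric.ball (Φ x) t) (Metric.ball x (s / 2)) := by
  obtain ⟨L₁, U, hU, hL₁⟩ := hΦ.exists_lipschitzOnWith
  obtain ⟨L₂, U', hU', hL₂⟩ := hΦs.exists_lipschitzOnWith
  obtain ⟨s, hs, hsU⟩ := Metric.mem_nhds_iff.1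
    (Filter.inter_mem hU (Φ.open_source.mem_nhds hx))
  have hpre : Φ.symm ⁻¹' Metric.ball x (s / 2) ∈ nhds (Φ x) := by
    refine hΦs.continuousAt.preimage_mem_nhds ?_
    rw [Φ.left_inv hx]
    exact Metric.ball_mem_nhds x (half_pos hs)
  obtain ⟨t, ht, htU⟩ := Metric.mem_nhds_iff.1
    (Filter.inter_mem (Filter.inter_mem hU' (Φ.open_target.mem_nhds (Φ.map_source hx))) hpre)
  exact ⟨L₁ + L₂ + 1, s, t, by positivity, hs, ht, fun y hy => (hsU hy).2,
    fun y hy => (htU hy).1.2,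
    (hL₁.mono fun y hy => (hsU hy).1).weaken (by rw [add_assoc]; exact le_self_add),
    (hL₂.mono fun y hy => (htU hy).1.1).weaken (le_add_right le_add_self),
    fun y hy => (htU hy).2⟩

section Lipschitz

variable {X Y ι : Type*} [PseudoMetricSpace X] [PseudoMetricSpace Y] {K V N' : Set Y}
  {D S N : Set X} {z : ι → Y} {r : ι → ℝ} {C : ℝ} {Φ : X → Y} {Ψ : Y → X} {L : ℝ≥0}

theorem HasRelativeGap.of_lipschitzOnWith {B : ℝ} (h : HasRelativeGap z r B) (hL : 0 < L)
    (hΦ : LipschitzOnWith L Φ N) (hN : ∀ b, Ψ (z b) ∈ N) (hinv : ∀ b, Φ (Ψ (z b)) = z b) :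
    HasRelativeGap (fun b => Ψ (z b)) (fun b => r b / L) B := by
  have hL' : (0 : ℝ) < L := hL
  intro b b' hne
  have hdist := hΦ.dist_le_mul _ (hN b) _ (hN b')
  rw [hinv b, hinv b'] at hdist
  rw [min_div_div_right hL'.le, ← add_div, mul_div_assoc', ← add_div, div_lt_iff₀' hL']
  exact (h b b' hne).trans_le hdist

theorem IsSeparatedBalls.of_lipschitzOnWith (h : IsSeparatedBalls K V z r C) (hL : 0 < L)
    (hΦ : LipschitzOnWith L Φ N) (hΨ : LipschitzOnWith L Ψ N') (hinv : RightInvOn Ψ Φ N')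
    (hD : ∀ y ∈ N, Φ y ∈ K → y ∈ D) (hS : ∀ y ∈ N', y ∈ V → Ψ y ∈ S)
    (hN : ∀ b, Metric.ball (Ψ (z b)) (2 * (r b / L)) ⊆ N)
    (hN' : ∀ b, Metric.closedBall (z b) (C * r b) ⊆ N') :
    IsSeparatedBalls D S (fun b => Ψ (z b)) (fun b => r b / L) (L * (C * L)) := by
  have hL' : (0 : ℝ) < L := hL
  have hpos (b : ι) : 0 < r b / L := div_pos (h.pos b) hL'
  have hzN' (b : ι) : z b ∈ N' := by
    obtain ⟨v, -, hv⟩ := h.exists_dist_le b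
    exact hN' b (Metric.mem_closedBall_self (dist_nonneg.trans hv))
  have hxN (b : ι) : Ψ (z b) ∈ N := hN b (Metric.mem_ball_self (mul_pos two_pos (hpos b)))
  refine ⟨hpos, fun b y hy => ?_, fun b => ?_, fun b b' hne => ?_, fun t ht => ?_⟩
  · refine hD y (hN b hy) (h.ball_subset b ?_)
    have hdist := hΦ.dist_le_mul y (hN b hy) _ (hxN b)
    rw [hinv (hzN' b)] at hdist
    refine Metric.mem_ball.2 (hdist.trans_lt ?_)
    calc L * dist y (Ψ (z b)) < L * (2 * (r b / L)) := mul_lt_mul_of_pos_left hy hL'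
      _ = 2 * r b := by field_simp
  · obtain ⟨v, hvV, hv⟩ := h.exists_dist_le b
    have hvN' : v ∈ N' := hN' b (Metric.mem_closedBall'.2 hv)
    refine ⟨Ψ v, hS v hvN' hvV, (hΨ.dist_le_mul _ (hzN' b) _ hvN').trans ?_⟩
    calc L * dist (z b) v ≤ L * (C * r b) := by gcongr
      _ = L * (C * L) * (r b / L) := by field_simp
  · have hdist := hΦ.dist_le_mul _ (hxN b) _ (hxN b')
    rw [hinv (hzN' b), hinv (hzN' b')] at hdist
    rw [← add_div, div_lt_iff₀' hL']
    exact (h.add_lt_dist b b' hne).trans_le hdist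
  · refine (h.finite (t * L) (mul_pos ht hL')).subset fun b hb => ?_
    exact (le_div_iff₀ hL').1 hb

end Lipschitz

namespace IsEdgePoint

variable {d δ : ℕ} {D S : Set (Eucl d)} {x₀ : Eucl d}

theorem mem (h : IsEdgePoint D S δ x₀) : x₀ ∈ S := by
  obtain ⟨V, K, Φ, -, -, -, -, -, -, -, hx₀, hΦx₀, hDS⟩ := h
  exact (hDS x₀ hx₀).1.2 (hΦx₀ ▸ V.zero_mem)

theorem exists_lipschitz_chart (h : IsEdgePoint D S δ x₀) (hSD : Disjoint S D) :
    ∃ (V : Submodule ℝ (Eucl d)) (K : Set (Eucl d)) (Ψ : Eucl d → Eucl d) (L : ℝ),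
      Module.finrank ℝ V = δ ∧ IsEdgeCone V K ∧ 0 < L ∧ ∀ C : ℝ, 0 < C → ∃ t : ℝ, 0 < t ∧
        ∀ {ι : Type*} {z : ι → Eucl d} {r : ι → ℝ}, IsSeparatedBalls K V z r C →
          (∀ b, r b ≤ t) → (∀ b, ‖z b‖ ≤ t) →
          IsSeparatedBalls D S (fun b => Ψ (z b)) (fun b => r b / L) (L * (C * L)) ∧
          ∀ {B : ℝ}, HasRelativeGap z r B →
            HasRelativeGap (fun b => Ψ (z b)) (fun b => r b / L) B := by
  have hx₀D : x₀ ∉ D := hSD.notMem_of_mem_left h.mem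
  obtain ⟨V, K, Φ, hV, hKo, hKne, hKsmul, hKadd, hΦ, hΦs, hx₀, hΦx₀, hDS⟩ := h
  have hK : IsEdgeCone V K :=
    ⟨hKo, hKne, hKsmul, hKadd, fun h0 => hx₀D ((hDS x₀ hx₀).2.2 (hΦx₀ ▸ h0))⟩
  obtain ⟨L, s, t, hL, hs, ht, hsource, htarget, hLΦ, hLΦs, hmaps⟩ :=
    exists_lipschitzOnWith_chart Φ hx₀
      ((hΦ.contDiffAt (Φ.open_source.mem_nhds hx₀)).of_le (mod_cast le_top))
      ((hΦs.contDiffAt (Φ.open_target.mem_nhds (Φ.map_source hx₀))).of_le (mod_cast le_top))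
  have hL' : (0 : ℝ) < L := hL
  have hinv : RightInvOn Φ.symm Φ (Metric.ball (Φ x₀) t) := fun y hy => Φ.right_inv (htarget hy)
  refine ⟨V, K, Φ.symm, L, hV, hK, hL', fun C hC => ?_⟩
  obtain ⟨t₁, ht₁, hlt⟩ := exists_pos_mul_lt
    (lt_min ht (mul_pos (half_pos (half_pos hs)) hL')) (1 + C)
  obtain ⟨htC, hts⟩ := lt_min_iff.1 hlt
  have hCt₁ : 0 < C * t₁ := mul_pos hC ht₁
  refine ⟨t₁, ht₁, fun {ι z r} hz hrt hzt => ?_⟩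
  have hclosedBall (b : ι) : Metric.closedBall (z b) (C * r b) ⊆ Metric.ball (Φ x₀) t := by
    refine Metric.closedBall_subset_ball' ?_
    rw [hΦx₀, dist_zero_right]
    nlinarith [hzt b, hrt b]
  have hzb (b : ι) : z b ∈ Metric.ball (Φ x₀) t :=
    hclosedBall b (Metric.mem_closedBall_self (mul_pos hC (hz.pos b)).le)
  have hball (b : ι) : Metric.ball (Φ.symm (z b)) (2 * (r b / L)) ⊆ Metric.ball x₀ s := by
    refine Metric.ball_subset_ball' ?_
    have hr : r b / L ≤ s / 2 / 2 := (div_le_iff₀ hL').2 (by linarith [hrt b])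
    linarith [Metric.mem_ball.1 (hmaps (hzb b))]
  exact ⟨hz.of_lipschitzOnWith hL hLΦ hLΦs hinv (fun y hy => (hDS y (hsource hy)).2.2)
      (fun y hy hyV => (hDS _ (Φ.map_target (htarget hy))).1.2 (by rwa [hinv hy])) hball
      hclosedBall,
    fun hgap => hgap.of_lipschitzOnWith hL hLΦ
      (fun b => hball b (Metric.mem_ball_self (mul_pos two_pos (div_pos (hz.pos b) hL'))))
      fun b => hinv (hzb b)⟩

theorem exists_isSeparatedBalls (h : IsEdgePoint D S δ x₀) (hSD : Disjoint S D) :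
    ∃ C : ℝ, 0 < C ∧ ∀ B r₀ : ℝ, 0 ≤ B → 0 < r₀ → ∃ (κ : ℝ) (R : ℕ), 0 < κ ∧ κ ≤ r₀ ∧ 2 ≤ R ∧
      ∃ x : EdgeIndex δ R → Eucl d, IsSeparatedBalls D S x (edgeRadius κ) C ∧
        HasRelativeGap x (edgeRadius κ) B := by
  obtain ⟨V, K, Ψ, L, hV, hK, hL, hchart⟩ := h.exists_lipschitz_chart hSD
  obtain ⟨C, hC, hcone⟩ := hK.exists_isSeparatedBalls hV
  obtain ⟨t, ht, himage⟩ := hchart C hC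
  refine ⟨L * (C * L), by positivity, fun B r₀ hB hr₀ => ?_⟩
  obtain ⟨κ, R, hκ, hκle, hR, z, hz, hzt, hgap⟩ :=
    hcone B (min t (r₀ * L)) hB (lt_min ht (mul_pos hr₀ hL))
  obtain ⟨hκt, hκr₀⟩ := le_min_iff.1 hκle
  have hradius : edgeRadius (δ := δ) (R := R) (κ / L) = fun b => edgeRadius κ b / L :=
    funext fun _ => div_mul_eq_mul_div _ _ _
  obtain ⟨hballs, hgaps⟩ := himage hz (fun b => (edgeRadius_le hκ hR b).trans hκt)
    fun b => (hzt b).trans (min_le_left _ _)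
  exact ⟨κ / L, R, div_pos hκ hL, (div_le_iff₀ hL).2 hκr₀, hR, _, hradius ▸ hballs,
    hradius ▸ hgaps hgap⟩

end IsEdgePoint

/-! ### Amplitudes along an edge -/

/-- The amplitude of the bumps of generation `n` along an edge. The factor `(n + 1) ^ (-(1 / τ))`
is summable to the power `p > τ`, but not to the power `τ`. -/
def edgeAmplitude {δ R : ℕ} (κ σ τ : ℝ) (b : EdgeIndex δ R) : ℝ :=
  edgeRadius κ b ^ σ * ((b.1 : ℝ) + 1) ^ (-(1 / τ))

section EdgeAmplitude

variable {δ R : ℕ} {κ : ℝ}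

theorem edgeAmplitude_nonneg (hκ : 0 < κ) (hR : 2 ≤ R) (σ τ : ℝ) (b : EdgeIndex δ R) :
    0 ≤ edgeAmplitude κ σ τ b := by
  have := edgeRadius_pos hκ hR b
  unfold edgeAmplitude
  positivity

theorem tsum_edgeRadius_rpow_mul (hκ : 0 < κ) (hR : 2 ≤ R) (f : ℕ → ℝ) :
    ∑' b : EdgeIndex δ R, ENNReal.ofReal (edgeRadius κ b ^ (δ : ℝ) * f b.1) =
      ENNReal.ofReal (κ ^ δ) * ∑' n, ENNReal.ofReal (f n) := by
  rw [ENNReal.tsum_sigma', ← ENNReal.tsum_mul_left]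
  refine tsum_congr fun n => ?_
  simp only [edgeRadius, tsum_fintype, Finset.sum_const, Finset.card_univ, Fintype.card_fun,
    Fintype.card_fin, nsmul_eq_mul]
  rw [← ENNReal.ofReal_natCast, ← ENNReal.ofReal_mul (by positivity),
    ← ENNReal.ofReal_mul (by positivity), Real.rpow_natCast, mul_pow, inv_pow]
  push_cast
  congr 1
  field_simp

theorem edgeAmplitude_rpow_mul (hκ : 0 < κ) (hR : 2 ≤ R) (σ τ q e : ℝ) (b : EdgeIndex δ R) :
    edgeAmplitude κ σ τ b ^ q * edgeRadius κ b ^ e =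
      edgeRadius κ b ^ (σ * q + e) * ((b.1 : ℝ) + 1) ^ (-(q / τ)) := by
  have hr := edgeRadius_pos hκ hR b
  unfold edgeAmplitude
  rw [Real.mul_rpow (by positivity) (by positivity), ← Real.rpow_mul hr.le,
    ← Real.rpow_mul (by positivity), Real.rpow_add hr, show -(1 / τ) * q = -(q / τ) by ring]
  ring

theorem tsum_edgeAmplitude_lt_top (hκ : 0 < κ) (hR : 2 ≤ R) {σ τ p e : ℝ} (hτ : 0 < τ)
    (hτp : τ < p) (he : σ * p + e = δ) :
    ∑' b : EdgeIndex δ R, ENNReal.ofReal (edgeAmplitude κ σ τ b ^ p * edgeRadius κ b ^ e) < ⊤ := by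
  have hsummable : Summable fun n : ℕ => ((n : ℝ) + 1) ^ (-(p / τ)) := by
    simpa only [Nat.cast_add, Nat.cast_one] using (summable_nat_add_iff 1).2
      (Real.summable_nat_rpow.2 (neg_lt_neg ((one_lt_div hτ).2 hτp)))
  simp_rw [edgeAmplitude_rpow_mul hκ hR, he]
  rw [tsum_edgeRadius_rpow_mul hκ hR fun n => ((n : ℝ) + 1) ^ (-(p / τ))]
  exact ENNReal.mul_lt_top ENNReal.ofReal_lt_top hsummable.tsum_ofReal_lt_top

theorem tsum_edgeAmplitude_eq_top (hκ : 0 < κ) (hκ1 : κ ≤ 1) (hR : 2 ≤ R) {σ τ e : ℝ}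
    (hτ : 0 < τ) (he : σ * τ + e ≤ δ) :
    ∑' b : EdgeIndex δ R, ENNReal.ofReal (edgeAmplitude κ σ τ b ^ τ * edgeRadius κ b ^ e) = ⊤ := by
  have hharmonic : ∑' n : ℕ, ENNReal.ofReal ((n : ℝ) + 1)⁻¹ = ⊤ := by
    by_contra hne
    refine Real.not_summable_natCast_inv ((summable_nat_add_iff 1).1
      ((ENNReal.summable_toReal hne).congr fun n => ?_))
    rw [ENNReal.toReal_ofReal (by positivity), Nat.cast_add, Nat.cast_one]
  have htop : ∑' b : EdgeIndex δ R,
      ENNReal.ofReal (edgeRadius κ b ^ (δ : ℝ) * ((b.1 : ℝ) + 1)⁻¹) = ⊤ := by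
    rw [tsum_edgeRadius_rpow_mul hκ hR fun n => ((n : ℝ) + 1)⁻¹, hharmonic,
      ENNReal.mul_top (ENNReal.ofReal_pos.2 (by positivity)).ne']
  refine top_unique (htop.symm.trans_le (ENNReal.tsum_le_tsum fun b =>
    ENNReal.ofReal_le_ofReal ?_))
  rw [edgeAmplitude_rpow_mul hκ hR, div_self hτ.ne', Real.rpow_neg_one]
  gcongr ?_ * _
  exact Real.rpow_le_rpow_of_exponent_ge (edgeRadius_pos hκ hR b)
    ((edgeRadius_le hκ hR b).trans hκ1) he

end EdgeAmplitude

/-! ### Failure of the embeddings -/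

section Exponents

variable {n a p : ℝ}

theorem edgeExponent_mul_add (d : ℝ) (hp : p ≠ 0) : (a - n / p) * p + (d + -a * p) = d - n := by
  field_simp
  ring

theorem edgeExponent_mul_add_le (d : ℝ) {s τ : ℝ} (hτ : 0 < τ) (h : n * (1 / τ - 1 / p) ≤ s - a) :
    (a - n / p) * τ + (d + -s * τ) ≤ d - n := by
  have hmul := mul_le_mul_of_nonneg_right h hτ.le
  have heq : n * (1 / τ - 1 / p) * τ = n - n / p * τ := by field_simp
  linarith

end Exponents

namespace IsEdgePoint

variable {d δ : ℕ} {D S : Set (Eucl d)} {x₀ : Eucl d} {ρ : Eucl d → ℝ} {s a p τ : ℝ}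

theorem exists_memKondratiev_eLpNorm_eq_top (hx₀ : IsEdgePoint D S δ x₀) (hD : IsOpen D)
    (hS : S ⊆ frontier D) (hρ : IsSmoothDistance D S ρ) (k : ℕ) (hτ : 0 < τ) (hτp : τ < p)
    (h : ((d : ℝ) - δ) * (1 / τ - 1 / p) ≤ s - a) :
    ∃ u : Eucl d → ℂ, MemKondratiev D ρ k a p u ∧
      eLpNorm (fun x => ρ x ^ (-s) • u x) (ENNReal.ofReal τ) (volume.restrict D) = ⊤ := by
  have hp : 0 < p := hτ.trans hτp
  have hSD : Disjoint S D := (disjoint_frontier_iff_isOpen.2 hD).mono_left hS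
  obtain ⟨C, hC, hballs⟩ := hx₀.exists_isSeparatedBalls hSD
  obtain ⟨k₁, k₂, r₀, hk₁, hk₂, hr₀, hcomp⟩ := hρ.exists_comparable ⟨x₀, hx₀.mem⟩ hSD hC
  obtain ⟨κ, R, hκ, hκle, hR, x, hx, -⟩ := hballs 0 (min r₀ 1) le_rfl (lt_min hr₀ one_pos)
  obtain ⟨hκr₀, hκ1⟩ := le_min_iff.1 hκle
  have hA := edgeAmplitude_nonneg (δ := δ) hκ hR (a - (d - δ) / p) τ
  have hρx := hcomp hx fun b => (edgeRadius_le hκ hR b).trans hκr₀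
  have hfinite := tsum_edgeAmplitude_lt_top (δ := δ) hκ hR hτ hτp
    ((edgeExponent_mul_add (a := a) d hp.ne').trans (sub_sub_cancel _ _))
  have hinfinite := tsum_edgeAmplitude_eq_top (δ := δ) hκ hκ1 hR hτ
    ((edgeExponent_mul_add_le d hτ h).trans_eq (sub_sub_cancel _ _))
  exact ⟨_, hx.memKondratiev_bumpSum hD hSD hA hk₁ hk₂ hρx hp hfinite k,
    hx.eLpNorm_bumpSum_eq_top hA hk₁ hk₂ hρx hτ hinfinite⟩

theorem dim_ne_zero (hx₀ : IsEdgePoint D S δ x₀) (hS : S ⊆ frontier D) : d ≠ 0 := by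
  rintro rfl
  simpa only [(isClopen_discrete D).frontier_eq, mem_empty_iff_false] using hS hx₀.mem

theorem exists_memKondratiev_rlocNorm_eq_top (hx₀ : IsEdgePoint D S δ x₀) (hD : IsOpen D)
    (hS : S ⊆ frontier D) (hρ : IsSmoothDistance D S ρ) {W : Set (ℕ × (Fin d → ℤ))}
    (hW : IsWhitneyDecomposition D W) {ψ : ℕ × (Fin d → ℤ) → Eucl d → ℝ}
    (hψ : IsResolutionOfUnity D W ψ) {φ₀ : 𝓢(Eucl d, ℂ)} (hφ₀ : φ₀ 0 = 1) (k : ℕ) {q : ℝ}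
    (hs : 1 ≤ s) (hτ : 0 < τ) (hτp : τ < p) (hq : 0 < q)
    (h : ((d : ℝ) - δ) * (1 / τ - 1 / p) ≤ s - a) :
    ∃ u : Eucl d → ℂ, MemKondratiev D ρ k a p u ∧ rlocNorm W ψ φ₀ s τ q u = ⊤ := by
  have hp : 0 < p := hτ.trans hτp
  have hSD : Disjoint S D := (disjoint_frontier_iff_isOpen.2 hD).mono_left hS
  have hSne : S.Nonempty := ⟨x₀, hx₀.mem⟩
  obtain ⟨C, hC, hballs⟩ := hx₀.exists_isSeparatedBalls hSD
  obtain ⟨B, ε, hB, hε, hε1, hrloc⟩ :=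
    hW.exists_rlocNorm_bumpSum_eq_top (hx₀.dim_ne_zero hS) hD hSne hS hψ hφ₀ hC
  obtain ⟨k₁, k₂, r₀, hk₁, hk₂, hr₀, hcomp⟩ := hρ.exists_comparable hSne hSD (div_pos hC hε)
  obtain ⟨κ, R, hκ, hκle, hR, x, hx, hgap⟩ := hballs B (min r₀ 1) hB (lt_min hr₀ one_pos)
  obtain ⟨hκr₀, hκ1⟩ := le_min_iff.1 hκle
  have hεκ : 0 < ε * κ := mul_pos hε hκ
  have hεκle : ε * κ ≤ κ := mul_le_of_le_one_left hκ.le hε1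
  have hradius (b : EdgeIndex δ R) : ε * edgeRadius κ b = edgeRadius (ε * κ) b :=
    (mul_assoc _ _ _).symm
  have hx' : IsSeparatedBalls D S x (edgeRadius (ε * κ)) (C / ε) :=
    funext hradius ▸ hx.shrink hε hε1
  have hA := edgeAmplitude_nonneg (δ := δ) hεκ hR (a - (d - δ) / p) τ
  have hρx := hcomp hx' fun b => (edgeRadius_le hεκ hR b).trans (hεκle.trans hκr₀)
  have hfinite := tsum_edgeAmplitude_lt_top (δ := δ) hεκ hR hτ hτp
    ((edgeExponent_mul_add (a := a) d hp.ne').trans (sub_sub_cancel _ _))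
  have hinfinite := tsum_edgeAmplitude_eq_top (δ := δ) hεκ (hεκle.trans hκ1) hR hτ
    ((edgeExponent_mul_add_le d hτ h).trans_eq (sub_sub_cancel _ _))
  simp only [← hradius] at hinfinite
  have htop := hrloc hx (fun b => (edgeRadius_le hκ hR b).trans hκ1) hgap hA hs hτ hq hinfinite
  simp only [hradius] at htop
  exact ⟨_, hx'.memKondratiev_bumpSum hD hSD hA hk₁ hk₂ hρx hp hfinite k, htop⟩

end IsEdgePoint

theorem proposition4p1_general {d δ k : ℕ} {D S : Set (Eucl d)} (hD : IsOpen D)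
    (hS : S ⊆ frontier D) {x₀ : Eucl d} (hx₀ : IsEdgePoint D S δ x₀) {ρ : Eucl d → ℝ}
    (hρ : IsSmoothDistance D S ρ) {s a p τ q : ℝ} (hs : 1 ≤ s) (hτ : 0 < τ) (hτp : τ < p)
    (hq : 0 < q) (h : ((d : ℝ) - δ) * (1 / τ - 1 / p) ≤ s - a) :
    (∃ u : Eucl d → ℂ, MemKondratiev D ρ k a p u ∧
      eLpNorm (fun x => ρ x ^ (-s) • u x) (ENNReal.ofReal τ) (volume.restrict D) = ⊤) ∧
    ∀ (W : Set (ℕ × (Fin d → ℤ))) (ψ : ℕ × (Fin d → ℤ) → Eucl d → ℝ) (φ₀ : 𝓢(Eucl d, ℂ)),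
      IsWhitneyDecomposition D W → IsResolutionOfUnity D W ψ → IsDyadicGenerator φ₀ →
      ∃ u : Eucl d → ℂ, MemKondratiev D ρ k a p u ∧ rlocNorm W ψ φ₀ s τ q u = ⊤ :=
  ⟨hx₀.exists_memKondratiev_eLpNorm_eq_top hD hS hρ k hτ hτp h,
    fun _ _ _ hW hψ hφ₀ => hx₀.exists_memKondratiev_rlocNorm_eq_top hD hS hρ hW hψ
      (hφ₀.1 0 (norm_zero.trans_le zero_le_one)) k hs hτ hτp hq h⟩

end

theorem proposition4p1 {d δ : ℕ} {D S : Set (Eucl d)} (hD : IsDomainWithSingularSet D S δ)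
    {ρ : Eucl d → ℝ} (hρ : IsSmoothDistance D S ρ)
    {m : ℕ} (hm : 1 ≤ m) {a p τ : ℝ} (hp : 1 < p) (hτ : 0 < τ) (hτp : τ < p)
    (h : ((m : ℝ) - a = ((d : ℝ) - δ) * (1 / τ - 1 / p) ∧ a < m) ∨
      ((d : ℝ) - δ) * (1 / τ - 1 / p) < (m : ℝ) - a) :
    (∃ u : Eucl d → ℂ, MemKondratiev D ρ m a p u ∧
      eLpNorm (fun x => ρ x ^ (-(m : ℝ)) • u x) (ENNReal.ofReal τ) (volume.restrict D) = ⊤) ∧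
    ∀ (W : Set (ℕ × (Fin d → ℤ))) (ψ : ℕ × (Fin d → ℤ) → Eucl d → ℝ) (φ₀ : 𝓢(Eucl d, ℂ)),
      IsWhitneyDecomposition D W → IsResolutionOfUnity D W ψ → IsDyadicGenerator φ₀ →
      ¬ KondratievEmbedsRloc D ρ m a p τ W ψ φ₀ := by
  obtain ⟨x₀, hx₀⟩ := hD.exists_edge
  have hle : ((d : ℝ) - δ) * (1 / τ - 1 / p) ≤ m - a := h.elim (fun h => h.1.ge) le_of_lt
  obtain ⟨hLτ, hrloc⟩ := proposition4p1_general (k := m) hD.isOpen hD.subset_frontier hx₀ hρ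
    (mod_cast hm) hτ hτp two_pos hle
  refine ⟨hLτ, fun W ψ φ₀ hW hψ hφ₀ ⟨C, hC⟩ => ?_⟩
  obtain ⟨u, hu, htop⟩ := hrloc W ψ φ₀ hW hψ hφ₀
  exact (hC u hu).1.2.ne htop
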